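/- Let $A$ be a non-unital, $\sigma$-unital, non-elementary, simple C*-algebra with property (SP). (Here *non-elementary* means that $A$ is not *-isomorphic to the algebra $\mathcal K(H)$ of compact operators on a Hilbert space $H$, and *(SP)* means that every nonzero hereditary C*-subalgebra of $A$ contains a nonzero projection.) Let $A^{**}$ be the enveloping von Neumann algebra of $A$, and regard $A \subseteq M(A) \subseteq A^{**}$, where $M(A)=\{x\in A^{**} : xA\subseteq A,\ Ax\subseteq A\}$ is the multiplier algebra. An open projection of $A$ is a projection of $A^{**}$ which is the supremum of an upward directed set of positive elements of $A$; it is called $\sigma$-compact if it is the range projection in $A^{**}$ of some $a\in A_+$, and an open projection $q$ is called pre-compact if $qa=aq=q$ for some $a\in A_+$. For an open projection $p$ put $\mathrm{Her}(p)=pA^{**}p\cap A$. Open projections $p,q$ are Cuntz equivalent, $[p]=[q]$, if there is a partial isometry $v\in A^{**}$ with $v^*v=p$, $vv^*=q$, such that $va\in A$ and $vav^*\in\mathrm{Her}(q)$ for all $a\in\mathrm{Her}(p)$, and $v^*b\in A$ and $v^*bv\in\mathrm{Her}(p)$ for all $b\in\mathrm{Her}(q)$. Then there are $\sigma$-compact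 open projections $p$ and $q$ of $A$ such that $[p]=[q]$, but there is no unitary $u\in M(A)$ with $u^*pu=q$. Moreover, $p$ and $q$ can be chosen so that, in addition, $p$ is pre-compact and $q$ is not pre-compact; thus pre-compactness is not preserved under Cuntz equivalence. -/

import Mathlib

open scoped ComplexOrder

universe u

noncomputable section

namespace CStarOpen

/-! ### Classes of C*-algebras -/

section Classes

variable (A : Type u) [NonUnitalCStarAlgebra A]

/-- `A` has no multiplicative unit. -/
def IsNonUnital : Prop :=
  ¬ ∃ e : A, ∀ a : A, e * a = a ∧ a * e = a

/-- `A` is simple: it is nonzero and has no norm-closed two-sided ideals except `0` and `A`. -/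
def IsSimpleCStar : Prop :=
  Nontrivial A ∧
    ∀ I : Submodule ℂ A, IsClosed (I : Set A) →
      (∀ a : A, ∀ x ∈ I, a * x ∈ I ∧ x * a ∈ I) → I = ⊥ ∨ I = ⊤

/-- `A` is elementary: it is *-isomorphic to the algebra `K(H)` of all compact operators on a
Hilbert space `H`, that is, `A` has an injective *-representation whose range is `K(H)`.
(Such an `H` embeds into `A`, so it is enough to let `H` live in the universe of `A`.) -/
def IsElementary : Prop :=
  ∃ (H : Type u) (_ : NormedAddCommGroup H) (_ : InnerProductSpace ℂ H) (_ : CompleteSpace H)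
    (φ : A →⋆ₙₐ[ℂ] (H →L[ℂ] H)),
    Function.Injective φ ∧ Set.range φ = {T : H →L[ℂ] H | IsCompactOperator T}

variable [PartialOrder A]

/-- `A` is σ-unital: it has a sequential approximate unit `e 0 ≤ e 1 ≤ ⋯` consisting of positive
contractions. -/
def IsSigmaUnital : Prop :=
  ∃ e : ℕ → A, Monotone e ∧ (Filter.map e Filter.atTop).IsIncreasingApproximateUnit

variable {A} in
/-- `B` is a hereditary C*-subalgebra of `A`: a norm-closed *-subalgebra such that
`0 ≤ a ≤ b` and `b ∈ B` imply `a ∈ B`. -/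
def IsHereditaryCStar (B : NonUnitalStarSubalgebra ℂ A) : Prop :=
  IsClosed (B : Set A) ∧ ∀ a b : A, 0 ≤ a → a ≤ b → b ∈ B → a ∈ B

/-- Property (SP): every nonzero hereditary C*-subalgebra contains a nonzero projection. -/
def HasSP : Prop :=
  ∀ B : NonUnitalStarSubalgebra ℂ A, IsHereditaryCStar B → (∃ b ∈ B, b ≠ 0) →
    ∃ e ∈ B, IsStarProjection e ∧ e ≠ 0

end Classes

/-! ### The enveloping von Neumann algebra `A**` -/

section Envelope

variable (A : Type u) [NonUnitalCStarAlgebra A] [PartialOrder A] [StarOrderedRing A]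

/-- The states of `A`: positive linear functionals of norm one. -/
def State : Type u :=
  {φ : A →ₚ[ℂ] ℂ // ‖(⟨φ.toLinearMap, map_continuous φ⟩ : A →L[ℂ] ℂ)‖ = 1}

/-- The Hilbert space of the universal representation: the Hilbert sum of the GNS spaces of all
the states of `A`. -/
abbrev UnivHilbert : Type u :=
  lp (fun φ : State A => φ.1.GNS) 2

/-- The universal representation of `A`: the direct sum of the GNS representations of all the
states of `A`. -/
def univRep : A →⋆ₙₐ[ℂ] (UnivHilbert A →L[ℂ] UnivHilbert A) where
  toFun a := lp.mapCLM 2 (fun φ : State A => φ.1.gnsNonUnitalStarAlgHom a) (norm_nonneg a)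
    (fun φ => NonUnitalStarAlgHom.norm_apply_le φ.1.gnsNonUnitalStarAlgHom a)
  map_smul' c a := by
    ext ξ φ
    simp
  map_zero' := by
    ext ξ φ
    simp
  map_add' a b := by
    ext ξ φ
    simp
  map_mul' a b := by
    ext ξ φ
    simp
  map_star' a := by
    rw [ContinuousLinearMap.star_eq_adjoint, ContinuousLinearMap.eq_adjoint_iff]
    intro ξ η
    rw [lp.inner_eq_tsum, lp.inner_eq_tsum]
    congr 1
    funext φ
    simp [map_star, ContinuousLinearMap.star_eq_adjoint, ContinuousLinearMap.adjoint_inner_left]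

theorem star_mem_range_univRep {x : UnivHilbert A →L[ℂ] UnivHilbert A}
    (hx : x ∈ Set.range (univRep A)) : star x ∈ Set.range (univRep A) := by
  obtain ⟨a, rfl⟩ := hx
  exact ⟨star a, map_star _ a⟩

/-- The enveloping von Neumann algebra of `A`, i.e. the bicommutant of `A` in its universal
representation.  This is the standard realization of the bidual `A**` as a von Neumann algebra;
`univRep A` is the canonical inclusion of `A` into `A**`. -/
def envelope : VonNeumannAlgebra (UnivHilbert A) where
  carrier := Set.centralizer (Set.centralizer (Set.range (univRep A)))
  mul_mem' := Set.mul_mem_centralizer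
  one_mem' := Set.one_mem_centralizer
  add_mem' := Set.add_mem_centralizer
  zero_mem' := Set.zero_mem_centralizer
  algebraMap_mem' c := fun y _ => (Algebra.commutes c y).symm
  star_mem' := by
    intro x hx
    refine Set.star_mem_centralizer' ?_ hx
    intro y hy
    exact Set.star_mem_centralizer' (fun _ => star_mem_range_univRep A) hy
  centralizer_centralizer' := by
    rw [Set.centralizer_centralizer_centralizer]

/-- The multiplier algebra `M(A)`, realized inside `A**` as the set of all `x ∈ A**` with
`x A ⊆ A` and `A x ⊆ A`. -/
def multiplierAlgebra : Set (UnivHilbert A →L[ℂ] UnivHilbert A) :=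
  {x | x ∈ envelope A ∧
    ∀ a : A, x * univRep A a ∈ Set.range (univRep A) ∧ univRep A a * x ∈ Set.range (univRep A)}

end Envelope

/-! ### Open projections -/

section OpenProjections

variable {A : Type u} [NonUnitalCStarAlgebra A] [PartialOrder A] [StarOrderedRing A]

/-- `p` is an open projection of `A`: a projection in `A**` that is the supremum (equivalently, the
strong limit) of an upward directed set of positive elements of `A`. -/
def IsOpenProjection (p : UnivHilbert A →L[ℂ] UnivHilbert A) : Prop :=
  p ∈ envelope A ∧ IsStarProjection p ∧
    ∃ S : Set A, S.Nonempty ∧ DirectedOn (· ≤ ·) S ∧ (∀ a ∈ S, 0 ≤ a) ∧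
      IsLUB (univRep A '' S) p

/-- The range projection `p_a` of `a`: the orthogonal projection onto the closure of the range of
`a` in the universal representation. -/
def rangeProjection (a : A) : UnivHilbert A →L[ℂ] UnivHilbert A :=
  (univRep A a).range.topologicalClosure.starProjection

/-- `p` is a σ-compact open projection of `A`: an open projection that is the range projection of
a positive element of `A`. -/
def IsSigmaCompactOpen (p : UnivHilbert A →L[ℂ] UnivHilbert A) : Prop :=
  IsOpenProjection p ∧ ∃ a : A, 0 ≤ a ∧ p = rangeProjection a

/-- `Her(p) = p A** p ∩ A`, for a projection `p ∈ A**`. -/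
def Her (p : UnivHilbert A →L[ℂ] UnivHilbert A) : Set A :=
  {a | ∃ x ∈ envelope A, univRep A a = p * x * p}

/-- Cuntz equivalence `[p] = [q]` of open projections of `A`: there is a partial isometry `v ∈ A**`
with `v* v = p`, `v v* = q` and `v a v* ∈ Her(q)` for all `a ∈ Her(p)`.  The remaining clauses
(`v a ∈ A`, and the same conditions for `v*` on `Her(q)`) make the relation visibly symmetric and
make `v` induce an isomorphism of the Hilbert `A`-modules which belong to `p` and `q`. -/
def CuntzEquiv (p q : UnivHilbert A →L[ℂ] UnivHilbert A) : Prop :=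
  ∃ v ∈ envelope A, star v * v = p ∧ v * star v = q ∧
    (∀ a ∈ Her p,
      (∃ b ∈ Her q, v * univRep A a * star v = univRep A b) ∧
      v * univRep A a ∈ Set.range (univRep A)) ∧
    (∀ b ∈ Her q,
      (∃ a ∈ Her p, star v * univRep A b * v = univRep A a) ∧
      star v * univRep A b ∈ Set.range (univRep A))

/-- The open projection `q` is pre-compact: `q a = a q = q` for some positive `a ∈ A`. -/
def IsPrecompact (q : UnivHilbert A →L[ℂ] UnivHilbert A) : Prop :=
  ∃ a : A, 0 ≤ a ∧ q * univRep A a = q ∧ univRep A a * q = q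

end OpenProjections

end CStarOpen

end

/-!
The projection `p` lives under a single projection `e` of `A`, hence is pre-compact, while `q` is a
sum of projections `q₀, q₁, …` which run off to infinity: `qₙ a → 0` for every `a` in `A`. If
`q a = q` held for some `a`, then `qₙ = qₙ a → 0`, which is absurd as `‖qₙ‖ = 1`; so `q` is not
pre-compact. A unitary multiplier `w` carries a pre-compact projection to a pre-compact one, because
`w* a w` lies in `A` along with `a`. Hence it suffices to realize such `p = ∑ vₙ* vₙ` and
`q = ∑ vₙ vₙ*` with partial isometries `vₙ` in `A` whose initial projections are pairwise orthogonal
and lie under `e`, and whose final projections are pairwise orthogonal and run off to infinity.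

*Construction of the `vₙ`* (`exists_partialIsometries`). Since `A` is not unital, the spectrum of a
strictly positive element `h` accumulates at `0`; property (SP), applied to spectral pieces of `h`
over disjoint intervals approaching `0`, gives the projections running off to infinity
(`exists_orthogonal_vanishing`). If some nonzero projection `f` had no proper nonzero subprojection,
then (SP) would give `f A f = ℂ f` (`exists_smul_of_minimal`), and left multiplication on the
Hilbert space `A f` would identify `A` with the compact operators (`isElementary_of_corner`). So
below `e` one can split off infinitely many orthogonal projections
(`exists_orthogonal_subprojections`). By simplicity and (SP) any two nonzero projections have
nonzero equivalent subprojections (`exists_partialIsometry`), which gives the `vₙ`.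

*Cuntz equivalence* (`cuntzEquiv_supportProjection`). The sum `w = ∑ vₙ` converges strongly to a
partial isometry from `p` to `q`. Let `Pₙ` be the partial sums of `p`. For `a` in `Her(p)` the
elements `w Pₙ a = (∑_{k < n} vₖ) a` lie in `A`, so `w a` lies in `A` once `Pₙ a → a` in norm. This
is the analytic point (`tendsto_mul_of_tendsto_strongly`): the positive elements `a* (1 - Pₙ) a`
decrease and tend to `0` on every positive functional, as these are vector functionals of the
universal representation, and a decreasing sequence with that property tends to `0` in norm
(`tendsto_zero_of_forall_positive`, a form of Dini's theorem which follows from Hahn–Banach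
separation).
-/

noncomputable section

namespace CStarOpen

variable {A : Type u} [NonUnitalCStarAlgebra A]

/-! ### Projections from property (SP) -/

section PropertySP
variable [PartialOrder A] [StarOrderedRing A]

open CFC Unitization CStarAlgebra in
/-- The elements on which `k` acts as a unit form a hereditary set: in the unitization,
`0 ≤ (1 - k) a (1 - k) ≤ (1 - k) b (1 - k) = 0`. -/
theorem mul_eq_self_of_nonneg_of_le {a b k : A} (ha : 0 ≤ a) (hab : a ≤ b)
    (hk : IsSelfAdjoint k) (h : k * b = b) : k * a = a := by
  suffices ∀ a b k : A⁺¹, 0 ≤ a → a ≤ b → IsSelfAdjoint k → k * b = b → k * a = a from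
    mod_cast this a b k ha.inr
      ((inr_le_iff a b (.of_nonneg ha) (.of_nonneg (ha.trans hab))).mpr hab) (hk.inr ℂ)
      (by exact_mod_cast h)
  intro a b k ha hab hk h
  have hs : sqrt a * (1 - k) = 0 := by
    rw [← norm_eq_zero, ← sq_eq_zero_iff, ← norm_star_mul_mul_self_of_nonneg, norm_eq_zero]
    refine le_antisymm ?_ <| star_left_conjugate_nonneg ha _
    have h2 := star_left_conjugate_le_conjugate hab (1 - k)
    have h3 : star (1 - k) * b = 0 := by simp [hk.star_eq, sub_mul, h]
    rwa [h3, zero_mul] at h2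
  have h4 : a * (1 - k) = 0 := by
    rw [← sqrt_mul_sqrt_self a ha, mul_assoc, hs, mul_zero]
  have h5 := congr(star $h4)
  simp only [star_mul, star_sub, star_one, hk.star_eq, star_zero, ha.star_eq, sub_mul,
    one_mul] at h5
  exact (sub_eq_zero.mp h5).symm

omit [PartialOrder A] [StarOrderedRing A] in
theorem mul_eq_self_comm {k y : A} (hk : IsSelfAdjoint k) (hy : IsSelfAdjoint y) :
    k * y = y ↔ y * k = y := by
  constructor <;> intro h <;> simpa [hk.star_eq, hy.star_eq] using congr(star $h)

/-- The elements of `A` for which the selfadjoint element `k` acts as a two-sided unit. -/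
def unitizedBy (k : A) (hk : IsSelfAdjoint k) : NonUnitalStarSubalgebra ℂ A where
  carrier := {y | k * y = y ∧ y * k = y}
  add_mem' := by
    rintro a b ⟨h1, h2⟩ ⟨h3, h4⟩
    exact ⟨by rw [mul_add, h1, h3], by rw [add_mul, h2, h4]⟩
  zero_mem' := by simp
  mul_mem' := by
    rintro a b ⟨h1, h2⟩ ⟨h3, h4⟩
    exact ⟨by rw [← mul_assoc, h1], by rw [mul_assoc, h4]⟩
  smul_mem' := by
    rintro c a ⟨h1, h2⟩
    exact ⟨by rw [mul_smul_comm, h1], by rw [smul_mul_assoc, h2]⟩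
  star_mem' := by
    rintro a ⟨h1, h2⟩
    exact ⟨by simpa [hk.star_eq] using congr(star $h2),
      by simpa [hk.star_eq] using congr(star $h1)⟩

theorem isHereditaryCStar_unitizedBy (k : A) (hk : IsSelfAdjoint k) :
    IsHereditaryCStar (unitizedBy k hk) := by
  refine ⟨?_, fun a b ha hab hb => ?_⟩
  · exact (isClosed_eq (by fun_prop) (by fun_prop)).inter (isClosed_eq (by fun_prop) (by fun_prop))
  · have h := mul_eq_self_of_nonneg_of_le ha hab hk hb.1
    exact ⟨h, (mul_eq_self_comm hk (.of_nonneg ha)).1 h⟩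

/-- Property (SP) for the hereditary subalgebra `unitizedBy k`. -/
theorem HasSP.exists_projection (hSP : HasSP A) {k y : A} (hk : IsSelfAdjoint k)
    (hy : y ≠ 0) (h1 : k * y = y) (h2 : y * k = y) :
    ∃ e : A, IsStarProjection e ∧ e ≠ 0 ∧ k * e = e ∧ e * k = e := by
  obtain ⟨e, he, hp, h0⟩ := hSP _ (isHereditaryCStar_unitizedBy k hk) ⟨y, ⟨h1, h2⟩, hy⟩
  exact ⟨e, hp, h0, he.1, he.2⟩

/-- A nonzero projection `e` in the spectral part of `d` over `[δ, ‖d‖]`. It is a unit for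
`k = min(d / δ, 1)`, and `d` is invertible on it: `s = k · max(d, δ)^(-1/2)` satisfies
`s d s = k³`. -/
theorem HasSP.exists_projection_cut (hSP : HasSP A) {d : A} (hd : 0 ≤ d) {δ : ℝ} (hδ : 0 < δ)
    (hδd : δ < ‖d‖) :
    ∃ e s k : A, IsStarProjection e ∧ e ≠ 0 ∧ IsSelfAdjoint s ∧ e * (s * d * s) = e ∧
      d * (s * s * e) = e ∧ k * e = e ∧ ‖d - δ • k‖ ≤ ‖d‖ - δ := by
  have hsa : IsSelfAdjoint d := .of_nonneg hd
  have hq : ∀ t ∈ quasispectrum ℝ d, 0 ≤ t ∧ t ≤ ‖d‖ := fun t ht =>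
    ⟨quasispectrum_nonneg_of_nonneg d hd t ht,
      (le_abs_self t).trans
        (NonUnitalIsometricContinuousFunctionalCalculus.norm_quasispectrum_le d ht)⟩
  have hmax : ∀ t : ℝ, 0 < max t δ := fun t => lt_max_of_lt_right hδ
  have hsq : ∀ t : ℝ, √(max t δ) ≠ 0 := fun t => (Real.sqrt_pos.2 (hmax t)).ne'
  let κ : ℝ → ℝ := fun t => min (t / δ) 1
  let σ : ℝ → ℝ := fun t => min (t / δ) 1 / √(max t δ)
  -- `η d` is nonzero as `δ < ‖d‖`, and `κ d` is a unit for it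
  let η : ℝ → ℝ := fun t => max (t - δ) 0
  have cκ : Continuous κ := by fun_prop
  have cη : Continuous η := by fun_prop
  have cσ : Continuous σ := by
    refine Continuous.div (by fun_prop) (by fun_prop) hsq
  have κ0 : κ 0 = 0 := by simp [κ]
  have σ0 : σ 0 = 0 := by simp [σ]
  have η0 : η 0 = 0 := by simp [η, hδ.le]
  have hκη : ∀ t, κ t * η t = η t := by
    intro t
    rcases le_total t δ with h | h
    · simp [η, h]
    · have : 1 ≤ t / δ := by rwa [le_div_iff₀ hδ, one_mul]
      simp [κ, this]
  set k := cfcₙ κ d with hk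
  set s := cfcₙ σ d with hs
  set y := cfcₙ η d with hy
  have ksa : IsSelfAdjoint k := cfcₙ_predicate κ d
  have ssa : IsSelfAdjoint s := cfcₙ_predicate σ d
  have h1 : k * y = y := by
    rw [hk, hy, ← cfcₙ_mul κ η d cκ.continuousOn κ0 cη.continuousOn η0]
    exact cfcₙ_congr fun t _ => hκη t
  have h2 : y * k = y := (mul_eq_self_comm ksa (cfcₙ_predicate η d)).1 h1
  have hdk : ‖d - y‖ ≤ δ := by
    have : d - y = cfcₙ (fun t => t - η t) d := by
      rw [cfcₙ_sub (fun t => t) η d (by fun_prop) rfl cη.continuousOn η0, cfcₙ_id' ℝ d]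
    rw [this]
    refine norm_cfcₙ_le fun t ht => ?_
    rw [Real.norm_eq_abs, abs_le]
    have := (hq t ht).1
    rcases le_total t δ with h | h
    · simp only [η, sub_nonpos.2 h, max_eq_right]; constructor <;> linarith
    · simp only [η, sub_nonneg.2 h, max_eq_left]; constructor <;> linarith
  have hy0 : y ≠ 0 := by
    intro h
    rw [h, sub_zero] at hdk
    linarith
  obtain ⟨e, he, he0, hke, hek⟩ := hSP.exists_projection ksa hy0 h1 h2
  have hsds : s * d * s = k * k * k := by
    conv_lhs => rw [← cfcₙ_id' ℝ d]
    rw [hs, hk]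
    rw [← cfcₙ_mul σ (fun x => x) d cσ.continuousOn σ0 (by fun_prop) rfl,
      ← cfcₙ_mul (fun x => σ x * x) σ d (cσ.mul continuous_id).continuousOn (by simp)
        cσ.continuousOn σ0,
      ← cfcₙ_mul κ κ d cκ.continuousOn κ0 cκ.continuousOn κ0,
      ← cfcₙ_mul (fun x => κ x * κ x) κ d (cκ.mul cκ).continuousOn (by simp [κ0])
        cκ.continuousOn κ0]
    refine cfcₙ_congr fun t ht => ?_
    have ht0 := (hq t ht).1
    have h3 : t / max t δ = min (t / δ) 1 := by
      rcases le_total t δ with h | h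
      · rw [max_eq_right h, min_eq_left]; exact (div_le_one hδ).2 h
      · rw [max_eq_left h, min_eq_right ((one_le_div hδ).2 h), div_self]; linarith
    have h4 : √(max t δ) * √(max t δ) = max t δ := Real.mul_self_sqrt (hmax t).le
    calc σ t * t * σ t = κ t * κ t * (t / (√(max t δ) * √(max t δ))) := by
          have := hsq t
          simp only [σ, κ]; field_simp
      _ = κ t * κ t * κ t := by rw [h4, h3]
  have hcomm : d * s = s * d := by
    have := (cfcₙ_commute_cfcₙ (fun x : ℝ => x) σ d).eq
    rwa [cfcₙ_id' ℝ d] at this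
  refine ⟨e, s, k, he, he0, ssa, ?_, ?_, hke, ?_⟩
  · rw [hsds, ← mul_assoc, ← mul_assoc, hek, hek, hek]
  · rw [← mul_assoc, ← mul_assoc, hcomm, hsds, mul_assoc, hke, mul_assoc, hke, hke]
  · have : d - δ • k = cfcₙ (fun t => t - δ • κ t) d := by
      rw [cfcₙ_sub (fun t => t) (fun t => δ • κ t) d (by fun_prop) rfl
        (by fun_prop) (by simp [κ0]), cfcₙ_id' ℝ d, cfcₙ_smul δ κ d cκ.continuousOn κ0]
    rw [this]
    refine norm_cfcₙ_le fun t ht => ?_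
    obtain ⟨h5, h6⟩ := hq t ht
    rw [Real.norm_eq_abs, abs_le]
    simp only [κ, smul_eq_mul]
    rcases le_total t δ with h | h
    · rw [min_eq_left ((div_le_one hδ).2 h), mul_div_cancel₀ _ hδ.ne']; constructor <;> linarith
    · rw [min_eq_right ((one_le_div hδ).2 h)]; constructor <;> linarith

omit [PartialOrder A] [StarOrderedRing A] in
/-- In a simple C*-algebra the two-sided annihilator ideal `{x | f A x = 0}` of a nonzero element
`f` is trivial. -/
theorem IsSimpleCStar.exists_mul_mul_ne_zero (hA : IsSimpleCStar A) {f g : A} (hf : f ≠ 0)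
    (hg : g ≠ 0) : ∃ b, f * b * g ≠ 0 := by
  by_contra! h
  let I : Submodule ℂ A :=
    { carrier := {x | ∀ b, f * b * x = 0}
      add_mem' := fun {x y} hx hy b => by rw [mul_add, hx b, hy b, add_zero]
      zero_mem' := fun b => mul_zero _
      smul_mem' := fun c x hx b => by rw [mul_smul_comm, hx b, smul_zero] }
  have hI : IsClosed (I : Set A) := by
    have : (I : Set A) = ⋂ b, {x | f * b * x = 0} := by ext x; simp [I]
    rw [this]
    exact isClosed_iInter fun b => isClosed_eq (by fun_prop) (by fun_prop)
  rcases hA.2 I hI fun a x hx => ⟨fun b => by rw [← mul_assoc, mul_assoc f b a, hx],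
      fun b => by rw [← mul_assoc, hx b, zero_mul]⟩ with h1 | h1
  · have : g ∈ I := h
    rw [h1] at this
    exact hg (by simpa using this)
  · have h2 : f * star f ∈ I := by rw [h1]; trivial
    have h3 : star (f * star f) * (f * star f) = 0 := by simpa using h2 (star f)
    exact hf (by simpa using (CStarRing.star_mul_self_eq_zero_iff _).1 h3)

/-- Any two nonzero projections of a simple C*-algebra with (SP) have nonzero subprojections
`w w* ≤ f` and `w* w ≤ g` which are equivalent: `w` is the polar part of a nonzero element of
`f A g`, cut down to where that element is bounded below. -/
theorem exists_partialIsometry (hA : IsSimpleCStar A) (hSP : HasSP A) {f g : A}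
    (hf : f ≠ 0) (hg : g ≠ 0) (hfp : IsStarProjection f) (hgp : IsStarProjection g) :
    ∃ w : A, w ≠ 0 ∧ w * star w * w = w ∧ f * w = w ∧ w * g = w := by
  obtain ⟨b, hb⟩ := hA.exists_mul_mul_ne_zero hf hg
  set x := f * b * g with hx
  have hfx : f * x = x := by rw [hx, ← mul_assoc, ← mul_assoc, hfp.isIdempotentElem.eq]
  have hxg : x * g = x := by rw [hx, mul_assoc, hgp.isIdempotentElem.eq]
  have hd : 0 < ‖star x * x‖ := by
    rw [CStarRing.norm_star_mul_self]; have := norm_pos_iff.2 hb; positivity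
  obtain ⟨e, s, k, he, he0, hs, h1, h2, -, -⟩ :=
    hSP.exists_projection_cut (star_mul_self_nonneg x) (half_pos hd) (half_lt_self hd)
  have hge : g * e = e := by
    have hgx : g * star x = star x := by
      simpa [hgp.isSelfAdjoint.star_eq] using congr(star $hxg)
    rw [← h2, ← mul_assoc, ← mul_assoc g, hgx]
  have heg : e * g = e := (mul_eq_self_comm hgp.isSelfAdjoint he.isSelfAdjoint).1 hge
  have hw : star (x * s * e) * (x * s * e) = e := by
    simp only [star_mul, he.isSelfAdjoint.star_eq, hs.star_eq]
    calc e * (s * star x) * (x * s * e) = e * (s * (star x * x) * s) * e := by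
          simp only [mul_assoc]
      _ = e := by rw [h1, he.isIdempotentElem.eq]
  refine ⟨x * s * e, ?_, ?_, ?_, ?_⟩
  · intro h
    rw [h] at hw
    exact he0 (by simpa using hw.symm)
  · rw [mul_assoc, hw, mul_assoc, he.isIdempotentElem.eq]
  · rw [← mul_assoc, ← mul_assoc, hfx]
  · rw [mul_assoc, heg]

/-- Under (SP), a projection `f` without proper nonzero subprojections satisfies `f A f = ℂ f`: the
projections cut from a positive `d` in `f A f` all equal `f`, so `‖d - δ f‖ ≤ ‖d‖ - δ` for every
`δ < ‖d‖`. -/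
theorem exists_smul_of_minimal (hSP : HasSP A) {f : A} (hfp : IsStarProjection f)
    (hmin : ∀ e : A, IsStarProjection e → f * e = e → e = 0 ∨ e = f) (y : A) :
    ∃ c : ℂ, f * y * f = c • f := by
  have key : ∀ d : A, 0 ≤ d → d * f = d → d = ‖d‖ • f := by
    intro d hd hdf
    have hfd : f * d = d := (mul_eq_self_comm hfp.isSelfAdjoint (.of_nonneg hd)).2 hdf
    have hle : ∀ δ, 0 < δ → δ < ‖d‖ → ‖d - δ • f‖ ≤ ‖d‖ - δ := by
      intro δ h0 h1
      obtain ⟨e, s, k, he, he0, hs, -, h2, hk, hn⟩ := hSP.exists_projection_cut hd h0 h1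
      have hfe : f * e = e := by rw [← h2, ← mul_assoc, hfd]
      have hef : e = f := (hmin e he hfe).resolve_left he0
      subst hef
      calc ‖d - δ • e‖ = ‖(d - δ • k) * e‖ := by rw [sub_mul, hdf, smul_mul_assoc, hk]
        _ ≤ ‖d - δ • k‖ * ‖e‖ := norm_mul_le _ _
        _ ≤ ‖d - δ • k‖ * 1 := by gcongr; exact he.norm_le
        _ ≤ _ := by rwa [mul_one]
    rcases eq_or_ne d 0 with rfl | hd0
    · simp
    have hpos := norm_pos_iff.2 hd0
    have hlim : ‖d - ‖d‖ • f‖ ≤ ‖d‖ - ‖d‖ := by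
      have hcl : closure (Set.Ioo 0 ‖d‖) ⊆ {δ : ℝ | ‖d - δ • f‖ ≤ ‖d‖ - δ} :=
        (isClosed_le (by fun_prop) (by fun_prop)).closure_subset_iff.2 fun δ h => hle δ h.1 h.2
      rw [closure_Ioo hpos.ne] at hcl
      exact hcl (Set.right_mem_Icc.2 hpos.le)
    rw [sub_self] at hlim
    exact sub_eq_zero.1 (norm_le_zero_iff.1 hlim)
  obtain ⟨x, hx0, -, hx⟩ := CStarAlgebra.exists_sum_four_nonneg y
  have h4 : ∀ i, f * x i * f = ‖f * x i * f‖ • f := fun i =>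
    key _ (by simpa [hfp.isSelfAdjoint.star_eq] using star_left_conjugate_nonneg (hx0 i) f)
      (by rw [mul_assoc, hfp.isIdempotentElem.eq])
  refine ⟨∑ i : Fin 4, Complex.I ^ (i : ℕ) * (‖f * x i * f‖ : ℂ), ?_⟩
  rw [Finset.sum_smul]
  conv_lhs => rw [hx]
  rw [Finset.mul_sum, Finset.sum_mul]
  refine Finset.sum_congr rfl fun i _ => ?_
  rw [mul_smul_comm, smul_mul_assoc, mul_smul, Complex.coe_smul, ← h4]

end PropertySP

/-! ### Minimal projections force the algebra to be elementary -/

section Elementary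

/-- A closed subspace of operators which contains the rank-one operators contains every compact
operator `T`: if `F` is spanned by an `ε/2`-net of the image of the unit ball, then
`‖T - P_F T‖ ≤ ε/2`. -/
theorem _root_.IsCompactOperator.mem_of_rankOne_mem {H : Type*} [NormedAddCommGroup H]
    [InnerProductSpace ℂ H] [CompleteSpace H] {T : H →L[ℂ] H} (hT : IsCompactOperator T)
    {R : Submodule ℂ (H →L[ℂ] H)} (hR : IsClosed (R : Set (H →L[ℂ] H)))
    (h : ∀ x y, InnerProductSpace.rankOne ℂ x y ∈ R) : T ∈ R := by
  rw [← SetLike.mem_coe, ← hR.closure_eq, Metric.mem_closure_iff]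
  intro ε hε
  obtain ⟨K, hK, hTK⟩ :=
    IsCompactOperator.image_closedBall_subset_compact (f := (T : H →ₗ[ℂ] H)) hT 1
  obtain ⟨t, -, htf, ht⟩ := hK.finite_cover_balls (half_pos hε)
  let F : Submodule ℂ H := Submodule.span ℂ t
  have : FiniteDimensional ℂ F := FiniteDimensional.span_of_finite ℂ htf
  refine ⟨F.starProjection ∘L T, ?_, ?_⟩
  · rw [(stdOrthonormalBasis ℂ F).starProjection_eq_sum_rankOne, ContinuousLinearMap.finsetSum_comp]
    refine R.sum_mem fun i _ => ?_
    rw [InnerProductSpace.rankOne_comp]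
    exact h _ _
  · rw [dist_eq_norm]
    refine lt_of_le_of_lt ?_ (half_lt_self hε)
    refine ContinuousLinearMap.opNorm_le_of_unit_norm (half_pos hε).le fun x hx => ?_
    obtain ⟨y, hy, hxy⟩ : ∃ y ∈ t, T x ∈ Metric.ball y (ε / 2) := by
      simpa using ht (hTK ⟨x, by simp [hx], rfl⟩)
    calc ‖(T - F.starProjection ∘L T) x‖ = ⨅ z : F, ‖T x - z‖ := F.starProjection_minimal _
      _ ≤ ‖T x - y‖ := ciInf_le ⟨0, by rintro _ ⟨z, rfl⟩; exact norm_nonneg _⟩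
          (⟨y, Submodule.subset_span hy⟩ : F)
      _ ≤ ε / 2 := by rw [← dist_eq_norm]; exact (Metric.mem_ball.1 hxy).le

/-- The left ideal `A f` of a projection `f`, as the subspace `{x | x f = x}`. -/
def leftIdeal (f : A) : Submodule ℂ A where
  carrier := {x | x * f = x}
  add_mem' := fun {x y} (hx : x * f = x) (hy : y * f = y) => by
    simp only [Set.mem_ofPred_eq, add_mul, hx, hy]
  zero_mem' := zero_mul _
  smul_mem' := fun c x (hx : x * f = x) => by simp only [Set.mem_ofPred_eq, smul_mul_assoc, hx]

theorem mem_leftIdeal {f x : A} : x ∈ leftIdeal f ↔ x * f = x := Iff.rfl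

theorem isClosed_leftIdeal (f : A) : IsClosed (leftIdeal f : Set A) :=
  isClosed_eq (f := fun x => x * f) (by fun_prop) (by fun_prop)

instance (f : A) : CompleteSpace (leftIdeal f) := (isClosed_leftIdeal f).completeSpace_coe

theorem coe_mul_eq {f : A} (x : leftIdeal f) : (x : A) * f = x := x.2

theorem mul_star_coe {f : A} (hf : IsStarProjection f) (x : leftIdeal f) :
    f * star (x : A) = star (x : A) := by
  simpa [hf.isSelfAdjoint.star_eq] using congr(star $(coe_mul_eq x))

/-- The functional `τ` with `f y f = τ(y) f`, for a projection `f` with `f A f = ℂ f`. -/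
theorem exists_cornerFunctional {f : A} (hf0 : f ≠ 0)
    (hmin : ∀ y : A, ∃ c : ℂ, f * y * f = c • f) :
    ∃ τ : A →ₗ[ℂ] ℂ, ∀ y, f * y * f = τ y • f := by
  choose τ hτ using hmin
  have hinj : Function.Injective fun c : ℂ => c • f := smul_left_injective ℂ hf0
  refine ⟨{ toFun := τ, map_add' := fun x y => hinj ?_, map_smul' := fun c x => hinj ?_ }, hτ⟩
  · simp only [add_smul]
    rw [← hτ, ← hτ, ← hτ, mul_add, add_mul]
  · simp only [smul_eq_mul, RingHom.id_apply, mul_smul]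
    rw [← hτ, ← hτ, mul_smul_comm, smul_mul_assoc]

theorem star_mul_eq_smul {f : A} (hf : IsStarProjection f) {τ : A →ₗ[ℂ] ℂ}
    (hτ : ∀ y, f * y * f = τ y • f) (x y : leftIdeal f) :
    star (x : A) * (y : A) = τ (star (x : A) * y) • f := by
  rw [← hτ, ← mul_assoc, mul_star_coe hf, mul_assoc, coe_mul_eq]

/-- The Hilbert space structure on `A f` for a projection `f` with `f A f = ℂ f`: the inner product
is determined by `⟪x, y⟫ f = x* y`, and its norm is the norm of `A`. -/
abbrev leftIdealInner {f : A} (hf : IsStarProjection f) (hf0 : f ≠ 0) (τ : A →ₗ[ℂ] ℂ)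
    (hτ : ∀ y, f * y * f = τ y • f) : InnerProductSpace ℂ (leftIdeal f) where
  inner x y := τ (star (x : A) * (y : A))
  norm_sq_eq_re_inner x := by
    have hinj : Function.Injective fun c : ℂ => c • f := smul_left_injective ℂ hf0
    let := CStarAlgebra.spectralOrder A
    let := CStarAlgebra.spectralOrderedRing A
    have hnf : ‖f‖ = 1 := by
      have h := CStarRing.norm_star_mul_self (x := f)
      rw [hf.isSelfAdjoint.star_eq, hf.isIdempotentElem.eq] at h
      have := norm_pos_iff.2 hf0
      nlinarith
    set c := τ (star (x : A) * x) with hc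
    have h1 : star (x : A) * x = c • f := star_mul_eq_smul hf hτ x x
    have h2 : (starRingEnd ℂ) c = c := by
      apply hinj
      have := congr(star $h1)
      rw [star_mul, star_star, star_smul, hf.isSelfAdjoint.star_eq, h1] at this
      exact this.symm
    have h3 : ((c.re : ℝ) : ℂ) = c := Complex.conj_eq_iff_re.1 h2
    have h4 : ‖x‖ ^ 2 = |c.re| := by
      rw [sq, Submodule.coe_norm, ← CStarRing.norm_star_mul_self, h1, norm_smul, hnf, mul_one, ← h3,
        Complex.norm_real, Complex.ofReal_re, Real.norm_eq_abs]
    rw [h4]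
    refine abs_of_nonneg ?_
    by_contra! hneg
    have h5 : 0 ≤ star (x : A) * x := star_mul_self_nonneg _
    have h6 : 0 ≤ (-c.re) • f := smul_nonneg (by linarith) hf.nonneg
    have h7 : star (x : A) * x = c.re • f := by rw [h1, ← h3, Complex.coe_smul, Complex.ofReal_re]
    have h8 : star (x : A) * x = 0 :=
      le_antisymm (by rw [h7]; rw [neg_smul] at h6; exact neg_nonneg.1 h6) h5
    rw [h8] at h7
    rcases smul_eq_zero.1 h7.symm with h | h
    · exact hneg.ne h
    · exact hf0 h
  conj_inner_symm x y := by
    apply smul_left_injective ℂ hf0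
    have := congr(star $(star_mul_eq_smul hf hτ y x))
    rw [star_mul, star_star, star_smul, hf.isSelfAdjoint.star_eq,
      star_mul_eq_smul hf hτ x y] at this
    exact this.symm
  add_left x y z := by simp [add_mul]
  smul_left x y c := by simp [smul_mul_assoc]

/-- Left multiplication of `A` on `A f`. -/
def leftMul (f : A) (a : A) : leftIdeal f →L[ℂ] leftIdeal f :=
  LinearMap.mkContinuous
    { toFun := fun x => ⟨a * x, by rw [mem_leftIdeal, mul_assoc, coe_mul_eq]⟩
      map_add' := fun x y => by ext; simp [mul_add]
      map_smul' := fun c x => by ext; simp [mul_smul_comm] } ‖a‖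
    fun x => norm_mul_le a (x : A)

theorem coe_leftMul (f a : A) (x : leftIdeal f) : (leftMul f a x : A) = a * x := rfl

/-- If `f A f = ℂ f`, then left multiplication on the Hilbert space `A f` is an isomorphism of the
simple algebra `A` onto the compact operators. -/
theorem isElementary_of_corner (hA : IsSimpleCStar A) {f : A} (hf : IsStarProjection f)
    (hf0 : f ≠ 0) (hmin : ∀ y : A, ∃ c : ℂ, f * y * f = c • f) : IsElementary A := by
  obtain ⟨τ, hτ⟩ := exists_cornerFunctional hf0 hmin
  let : InnerProductSpace ℂ (leftIdeal f) := leftIdealInner hf hf0 τ hτ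
  have hinner : ∀ x y : leftIdeal f, star (x : A) * (y : A) = inner ℂ x y • f :=
    star_mul_eq_smul hf hτ
  let φ : A →⋆ₙₐ[ℂ] (leftIdeal f →L[ℂ] leftIdeal f) :=
    { toFun := leftMul f
      map_smul' := fun c a => by ext x; simp [coe_leftMul, smul_mul_assoc]
      map_zero' := by ext x; simp [coe_leftMul]
      map_add' := fun a b => by ext x; simp [coe_leftMul, add_mul]
      map_mul' := fun a b => by ext x; simp [coe_leftMul, mul_assoc]
      map_star' := fun a => by
        rw [ContinuousLinearMap.star_eq_adjoint, ContinuousLinearMap.eq_adjoint_iff]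
        intro x y
        apply smul_left_injective ℂ hf0
        simp only
        rw [← hinner, ← hinner, coe_leftMul, coe_leftMul, star_mul, star_star, mul_assoc] }
  have hφ : ∀ a (x : leftIdeal f), (φ a x : A) = a * x := fun a x => rfl
  have hφc : Continuous φ := by
    refine AddMonoidHomClass.continuous_of_bound φ 1 fun a => ?_
    rw [one_mul]
    exact NonUnitalStarAlgHom.norm_apply_le φ a
  let f' : leftIdeal f := ⟨f, hf.isIdempotentElem.eq⟩
  -- the rank-one operators come from the elements `x y*` with `x, y ∈ A f`
  have hrank : ∀ x y z : leftIdeal f, φ ((x : A) * star (y : A)) z = inner ℂ y z • x := by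
    intro x y z
    ext
    rw [hφ, mul_assoc, hinner, mul_smul_comm, coe_mul_eq]; rfl
  have hinj : Function.Injective φ := by
    rw [injective_iff_map_eq_zero]
    intro a ha
    by_contra ha0
    obtain ⟨b, hb⟩ := hA.exists_mul_mul_ne_zero ha0 hf0
    have h1 : φ a ⟨b * f, by rw [mem_leftIdeal, mul_assoc, hf.isIdempotentElem.eq]⟩ = 0 := by
      rw [ha]; rfl
    exact hb (by simpa [hφ, mul_assoc] using congr(($h1 : A)))
  have hiso : Isometry φ := AddMonoidHomClass.isometry_of_norm φ fun a =>
    NonUnitalStarAlgHom.norm_map φ hinj a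
  have hclosed : IsClosed (Set.range φ) := hiso.isClosedEmbedding.isClosed_range
  refine ⟨leftIdeal f, inferInstance, inferInstance, inferInstance, φ, hinj, ?_⟩
  apply Set.Subset.antisymm
  · -- the preimage of the compact operators is a nonzero closed ideal
    let I : Submodule ℂ A := (compactOperator (RingHom.id ℂ) (leftIdeal f) (leftIdeal f)).comap
      (φ : A →ₗ[ℂ] (leftIdeal f →L[ℂ] leftIdeal f))
    have hI : IsClosed (I : Set A) :=
      (isClosed_setOfPred_isCompactOperator (σ₁₂ := RingHom.id ℂ)).preimage hφc
    have hfI : f ∈ I := by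
      have : φ f = InnerProductSpace.rankOne ℂ f' f' := by
        ext1 z
        rw [InnerProductSpace.rankOne_apply, ← hrank, hf.isSelfAdjoint.star_eq,
          hf.isIdempotentElem.eq]
      show IsCompactOperator (φ f)
      rw [this, InnerProductSpace.rankOne_def']
      exact (isCompactOperator_of_locallyCompactSpace_rng
        (ContinuousLinearMap.toSpanSingleton ℂ f')).comp_clm _
    have hideal : ∀ a : A, ∀ x ∈ I, a * x ∈ I ∧ x * a ∈ I := by
      intro a x hx
      constructor
      · show IsCompactOperator (φ (a * x))
        rw [map_mul]
        exact IsCompactOperator.clm_comp (f := φ x) hx (φ a)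
      · show IsCompactOperator (φ (x * a))
        rw [map_mul]
        exact IsCompactOperator.comp_clm (f := φ x) hx (φ a)
    rcases hA.2 I hI hideal with h | h
    · rw [h] at hfI
      exact absurd (by simpa using hfI) hf0
    · rintro _ ⟨a, rfl⟩
      have : a ∈ I := by rw [h]; trivial
      exact this
  · intro T hT
    refine hT.mem_of_rankOne_mem (R := LinearMap.range
      (φ : A →ₗ[ℂ] (leftIdeal f →L[ℂ] leftIdeal f))) hclosed fun x y => ?_
    exact ⟨x * star (y : A), by ext1 z; exact hrank x y z⟩

end Elementary

/-! ### Sequences of orthogonal projections -/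

section Sequences
open Filter Topology

variable [PartialOrder A] [StarOrderedRing A]

theorem exists_proper_subprojection (hA : IsSimpleCStar A) (hSP : HasSP A) (hE : ¬ IsElementary A)
    {e : A} (he : IsStarProjection e) (he0 : e ≠ 0) :
    ∃ f : A, IsStarProjection f ∧ f ≠ 0 ∧ e * f = f ∧ f ≠ e := by
  by_contra! h
  refine hE (isElementary_of_corner hA he he0 (exists_smul_of_minimal hSP he fun f hf hef => ?_))
  by_contra! h2
  exact h2.2 (h f hf h2.1 hef)

/-- The successive differences of a strictly decreasing sequence of projections starting at `e`. -/
theorem exists_orthogonal_subprojections (hA : IsSimpleCStar A) (hSP : HasSP A)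
    (hE : ¬ IsElementary A) {e : A} (he : IsStarProjection e) (he0 : e ≠ 0) :
    ∃ p : ℕ → A, (∀ n, IsStarProjection (p n)) ∧ (∀ n, p n ≠ 0) ∧
      (Pairwise fun m n => p m * p n = 0) ∧ ∀ n, e * p n = p n := by
  have hstep : ∀ f : {f : A // IsStarProjection f ∧ f ≠ 0},
      ∃ g : {f : A // IsStarProjection f ∧ f ≠ 0}, (f : A) * g = g ∧ (g : A) ≠ f := fun f =>
    let ⟨g, h1, h2, h3, h4⟩ := exists_proper_subprojection hA hSP hE f.2.1 f.2.2
    ⟨⟨g, h1, h2⟩, h3, h4⟩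
  choose F hF hF' using hstep
  let E : ℕ → {f : A // IsStarProjection f ∧ f ≠ 0} := fun n => F^[n] ⟨e, he, he0⟩
  have hE1 : ∀ n, E (n + 1) = F (E n) := fun n => Function.iterate_succ_apply' F n _
  have hEle : ∀ m n, m ≤ n → (E m : A) * E n = E n := by
    intro m n h
    induction n, h using Nat.le_induction with
    | base => exact (E m).2.1.isIdempotentElem.eq
    | succ n _ ih =>
      have h2 : (E n : A) * E (n + 1) = E (n + 1) := by rw [hE1]; exact hF _
      rw [← h2, ← mul_assoc, ih]
  have hEle' : ∀ m n, m ≤ n → (E n : A) * E m = E n := fun m n h =>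
    (mul_eq_self_comm (E m).2.1.isSelfAdjoint (E n).2.1.isSelfAdjoint).1 (hEle m n h)
  refine ⟨fun n => E n - E (n + 1), fun n => ?_, fun n h => ?_, ?_, fun n => ?_⟩
  · exact (E (n + 1)).2.1.sub_of_mul_eq_right (E n).2.1 (hEle _ _ n.le_succ)
  · refine hF' (E n) ?_
    rw [← hE1]
    exact (sub_eq_zero.1 h).symm
  · intro m n hmn
    simp only [mul_sub, sub_mul]
    rcases hmn.lt_or_gt with h | h
    · rw [hEle _ _ h.le, hEle _ _ (h.le.trans n.le_succ), hEle _ _ h,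
        hEle _ _ (Nat.succ_le_succ h.le)]
      abel
    · rw [hEle' _ _ h.le, hEle' _ _ (h.le.trans m.le_succ), hEle' _ _ h,
        hEle' _ _ (Nat.succ_le_succ h.le)]
      abel
  · have h0 : (E 0 : A) = e := rfl
    rw [mul_sub, ← h0, hEle _ _ n.zero_le, hEle _ _ (n + 1).zero_le]

/-- A strictly positive element: it dominates, up to scalars, a sequential approximate unit. -/
theorem IsSigmaUnital.exists_strictlyPositive (hσ : IsSigmaUnital A) :
    ∃ (h : A) (e : ℕ → A) (c : ℕ → ℝ), 0 ≤ h ∧ (∀ n, 0 ≤ e n) ∧ (∀ n, 0 < c n) ∧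
      (∀ n, e n ≤ c n • h) ∧ ∀ a, Tendsto (fun n => e n * a) atTop (𝓝 a) := by
  obtain ⟨e, -, he⟩ := hσ
  have h1 : ∀ᶠ n in atTop, 0 ≤ e n := he.eventually_nonneg
  have h2 : ∀ᶠ n in atTop, ‖e n‖ ≤ 1 := he.eventually_norm
  obtain ⟨N, hN⟩ := eventually_atTop.1 (h1.and h2)
  have hpos : ∀ n, 0 ≤ e (n + N) := fun n => (hN _ (Nat.le_add_left _ _)).1
  have hterm : ∀ n : ℕ, 0 ≤ ((1 / 2 : ℝ) ^ n) • e (n + N) := fun n =>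
    smul_nonneg (by positivity) (hpos n)
  have hsum : Summable fun n : ℕ => ((1 / 2 : ℝ) ^ n) • e (n + N) := by
    refine Summable.of_norm_bounded (g := fun n : ℕ => (1 / 2 : ℝ) ^ n)
      summable_geometric_two fun n => ?_
    rw [norm_smul, Real.norm_of_nonneg (by positivity)]
    exact mul_le_of_le_one_right (by positivity) (hN _ (Nat.le_add_left _ _)).2
  refine ⟨∑' n, ((1 / 2 : ℝ) ^ n) • e (n + N), fun n => e (n + N), fun n => 2 ^ n,
    tsum_nonneg hterm, hpos, fun n => by positivity, fun n => ?_, fun a => ?_⟩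
  · have h3 := hsum.le_tsum n fun m _ => hterm m
    calc e (n + N) = (2 ^ n : ℝ) • ((1 / 2 : ℝ) ^ n) • e (n + N) := by
          rw [smul_smul, ← mul_pow]; norm_num
      _ ≤ _ := smul_le_smul_of_nonneg_left h3 (by positivity)
  · exact ((he.tendsto_mul_right a).comp tendsto_map).comp (tendsto_add_atTop_nat N)

/-- In a non-unital algebra, `0` is an accumulation point of the spectrum of a strictly positive
element; otherwise its support projection would be a unit. -/
theorem exists_mem_quasispectrum_lt (hnu : IsNonUnital A) {h : A} (h0 : 0 ≤ h) {e : ℕ → A}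
    {c : ℕ → ℝ} (he : ∀ n, 0 ≤ e n) (hec : ∀ n, e n ≤ c n • h)
    (hlim : ∀ a, Tendsto (fun n => e n * a) atTop (𝓝 a)) {ε : ℝ} (hε : 0 < ε) :
    ∃ t ∈ quasispectrum ℝ h, 0 < t ∧ t < ε := by
  by_contra! hgap
  have hsa : IsSelfAdjoint h := .of_nonneg h0
  let κ : ℝ → ℝ := fun t => min (t / ε) 1
  have κ0 : κ 0 = 0 := by simp [κ]
  have cκ : Continuous κ := by fun_prop
  have hrsa : IsSelfAdjoint (cfcₙ κ h) := cfcₙ_predicate κ h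
  have hrh : cfcₙ κ h * h = h := by
    nth_rewrite 2 [← cfcₙ_id' ℝ h]
    rw [← cfcₙ_mul κ (fun x => x) h cκ.continuousOn κ0 (by fun_prop) rfl]
    conv_rhs => rw [← cfcₙ_id' ℝ h]
    refine cfcₙ_congr fun t ht => ?_
    rcases (quasispectrum_nonneg_of_nonneg h h0 t ht).eq_or_lt with h2 | h2
    · simp [← h2]
    · have h3 : κ t = 1 := min_eq_right ((one_le_div hε).2 (hgap t ht h2))
      simp [h3]
  have hre : ∀ n, cfcₙ κ h * e n = e n := fun n =>
    mul_eq_self_of_nonneg_of_le (he n) (hec n) hrsa (by rw [mul_smul_comm, hrh])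
  have hra : ∀ a, cfcₙ κ h * a = a := fun a => by
    have h1 : Tendsto (fun n => cfcₙ κ h * (e n * a)) atTop (𝓝 (cfcₙ κ h * a)) :=
      tendsto_const_nhds.mul (hlim a)
    simp only [← mul_assoc, hre] at h1
    exact tendsto_nhds_unique h1 (hlim a)
  exact hnu ⟨_, fun a => ⟨hra a, by simpa [hrsa.star_eq] using congr(star $(hra (star a)))⟩⟩

/-- Projections which tend to `0` on a strictly positive element tend to `0` strictly. -/
theorem tendsto_projection_mul_zero {h : A} {e : ℕ → A} {c : ℕ → ℝ} (he : ∀ n, 0 ≤ e n)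
    (hc : ∀ n, 0 < c n) (hec : ∀ n, e n ≤ c n • h)
    (hlim : ∀ a, Tendsto (fun n => e n * a) atTop (𝓝 a)) {q : ℕ → A}
    (hq : ∀ n, IsStarProjection (q n)) (hqh : Tendsto (fun n => q n * h) atTop (𝓝 0)) (a : A) :
    Tendsto (fun n => q n * a) atTop (𝓝 0) := by
  have hqe : ∀ k, Tendsto (fun n => ‖q n * e k‖) atTop (𝓝 0) := by
    intro k
    set s := CFC.sqrt (e k) with hs
    have hss : s * s = e k := CFC.sqrt_mul_sqrt_self (e k) (he k)
    have hssa : IsSelfAdjoint s := .of_nonneg (CFC.sqrt_nonneg _)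
    have hbound : ∀ n, ‖q n * s‖ ^ 2 ≤ c k * ‖q n * h‖ := by
      intro n
      have hqs := (hq n).isSelfAdjoint
      have h1 : q n * e k * q n ≤ q n * (c k • h) * q n := by
        simpa [hqs.star_eq] using star_left_conjugate_le_conjugate (hec k) (q n)
      have h2 : 0 ≤ q n * e k * q n := by
        simpa [hqs.star_eq] using star_left_conjugate_nonneg (he k) (q n)
      calc ‖q n * s‖ ^ 2 = ‖q n * e k * q n‖ := by
            rw [sq, ← CStarRing.norm_self_mul_star, star_mul, hssa.star_eq, hqs.star_eq,
              ← hss]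
            simp only [mul_assoc]
        _ ≤ ‖q n * (c k • h) * q n‖ := CStarAlgebra.norm_le_norm_of_nonneg_of_le h2 h1
        _ = c k * ‖q n * h * q n‖ := by
            rw [mul_smul_comm, smul_mul_assoc, norm_smul, Real.norm_of_nonneg (hc k).le]
        _ ≤ c k * (‖q n * h‖ * 1) := by
            have := hc k
            gcongr
            exact (norm_mul_le _ _).trans (by gcongr; exact (hq n).norm_le)
        _ = _ := by rw [mul_one]
    have h3 : Tendsto (fun n => ‖q n * s‖ ^ 2) atTop (𝓝 0) := by
      refine squeeze_zero (fun n => by positivity) hbound ?_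
      simpa using hqh.norm.const_mul (c k)
    have h4 : Tendsto (fun n => ‖q n * s‖) atTop (𝓝 0) := by
      have := h3.sqrt
      simpa [Real.sqrt_sq] using this
    refine squeeze_zero (fun n => norm_nonneg _) (fun n => ?_) (by simpa using h4.mul_const ‖s‖)
    rw [← hss, ← mul_assoc]
    exact norm_mul_le _ _
  rw [tendsto_zero_iff_norm_tendsto_zero, Metric.tendsto_atTop]
  intro ε hε
  obtain ⟨k, hk⟩ := ((Metric.tendsto_nhds.1 (hlim a)) (ε / 2) (half_pos hε)).exists
  have h5 : Tendsto (fun n => ‖q n * e k‖ * ‖a‖) atTop (𝓝 0) := by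
    simpa using (hqe k).mul_const ‖a‖
  obtain ⟨N, hN⟩ := eventually_atTop.1 (h5.eventually_lt_const (half_pos hε))
  refine ⟨N, fun n hn => ?_⟩
  rw [dist_zero_right, norm_norm]
  rw [dist_eq_norm, norm_sub_rev] at hk
  calc ‖q n * a‖ = ‖q n * (a - e k * a) + q n * e k * a‖ := by
        rw [mul_sub, mul_assoc]; abel_nf
    _ ≤ ‖q n‖ * ‖a - e k * a‖ + ‖q n * e k‖ * ‖a‖ :=
        (norm_add_le _ _).trans (add_le_add (norm_mul_le _ _) (norm_mul_le _ _))
    _ ≤ 1 * ‖a - e k * a‖ + ‖q n * e k‖ * ‖a‖ := by gcongr; exact (hq n).norm_le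
    _ < ε / 2 + ε / 2 := by rw [one_mul]; exact add_lt_add hk (hN n hn)
    _ = ε := add_halves ε

/-- Positive numbers which satisfy `P` and decrease at least geometrically with ratio `1 / 4`. -/
theorem exists_seq_quarter {P : ℝ → Prop} (hP : ∀ ε : ℝ, 0 < ε → ∃ t, P t ∧ 0 < t ∧ t < ε) :
    ∃ t : ℕ → ℝ, (∀ n, P (t n)) ∧ (∀ n, 0 < t n) ∧ Tendsto t atTop (𝓝 0) ∧
      ∀ m n, m < n → t n ≤ t m / 4 := by
  choose! T hT1 hT2 hT3 using hP
  let t : ℕ → ℝ := fun n => (fun x => T (x / 4))^[n] (T 1)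
  have hs : ∀ n, t (n + 1) = T (t n / 4) := fun n => Function.iterate_succ_apply' _ n _
  have h0 : ∀ n, 0 < t n := by
    intro n
    induction n with
    | zero => exact hT2 1 one_pos
    | succ n ih => rw [hs]; exact hT2 _ (by linarith)
  have hle : ∀ n, t (n + 1) ≤ t n / 4 := fun n => by
    rw [hs]; exact (hT3 _ (by linarith [h0 n])).le
  have hanti : Antitone t := antitone_nat_of_succ_le fun n => by linarith [hle n, h0 n]
  refine ⟨t, fun n => ?_, h0, ?_, fun m n hmn => (hanti hmn).trans (hle m)⟩
  · cases n with
    | zero => exact hT1 1 one_pos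
    | succ n => rw [hs]; exact hT1 _ (by linarith [h0 n])
  · have hb : ∀ n, t n ≤ t 0 * (1 / 4) ^ n := by
      intro n
      induction n with
      | zero => simp
      | succ n ih => calc t (n + 1) ≤ t n / 4 := hle n
          _ ≤ t 0 * (1 / 4) ^ n / 4 := by gcongr
          _ = _ := by ring
    refine squeeze_zero (fun n => (h0 n).le) hb ?_
    simpa using (tendsto_pow_atTop_nhds_zero_of_lt_one (r := (1 / 4 : ℝ)) (by norm_num)
      (by norm_num)).const_mul (t 0)

/-- A non-unital σ-unital C*-algebra with (SP) has orthogonal projections tending strictly to `0`.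
They come from disjoint spectral pieces, approaching `0`, of a strictly positive element. -/
theorem exists_orthogonal_vanishing (hnu : IsNonUnital A) (hσ : IsSigmaUnital A) (hSP : HasSP A) :
    ∃ q : ℕ → A, (∀ n, IsStarProjection (q n)) ∧ (∀ n, q n ≠ 0) ∧
      (Pairwise fun m n => q m * q n = 0) ∧
      ∀ a, Tendsto (fun n => q n * a) atTop (𝓝 0) := by
  obtain ⟨h, e, c, h0, he, hc, hec, hlim⟩ := hσ.exists_strictlyPositive
  have hsa : IsSelfAdjoint h := .of_nonneg h0
  obtain ⟨t, htσ, htpos, htlim, hquarter⟩ := exists_seq_quarter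
    (P := fun t => t ∈ quasispectrum ℝ h) fun ε hε => by
      obtain ⟨t, h1, h2⟩ := exists_mem_quasispectrum_lt hnu h0 he hec hlim hε
      exact ⟨t, h1, h2⟩
  -- `κ n` is a bump supported in `|x - t n| ≤ t n / 2` which is `1` on the support
  -- `|x - t n| ≤ t n / 4` of `η n`; as `t (n + 1) ≤ t n / 4`, the supports are disjoint
  let κ : ℕ → ℝ → ℝ := fun n x => min 1 (max 0 (2 - 4 / t n * |x - t n|))
  let η : ℕ → ℝ → ℝ := fun n x => max 0 (t n / 4 - |x - t n|)
  have cκ : ∀ n, Continuous (κ n) := fun n => by fun_prop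
  have cη : ∀ n, Continuous (η n) := fun n => by fun_prop
  have hκ1 : ∀ n x, |x - t n| ≤ t n / 4 → κ n x = 1 := by
    intro n x hx
    have : 4 / t n * |x - t n| ≤ 1 := by
      rw [div_mul_eq_mul_div, div_le_one (htpos n)]; linarith
    exact min_eq_left (le_max_of_le_right (by linarith))
  have hκ0 : ∀ n x, t n / 2 ≤ |x - t n| → κ n x = 0 := by
    intro n x hx
    have : 2 ≤ 4 / t n * |x - t n| := by
      rw [div_mul_eq_mul_div, le_div_iff₀ (htpos n)]; linarith
    simp only [κ]
    rw [max_eq_left (by linarith)]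
    simp
  have hη0 : ∀ n x, t n / 4 ≤ |x - t n| → η n x = 0 := fun n x hx =>
    max_eq_left (by linarith)
  have habs0 : ∀ n, |0 - t n| = t n := fun n => by rw [zero_sub, abs_neg, abs_of_pos (htpos n)]
  have κz : ∀ n, κ n 0 = 0 := fun n => hκ0 n 0 (by rw [habs0]; linarith [htpos n])
  have ηz : ∀ n, η n 0 = 0 := fun n => hη0 n 0 (by rw [habs0]; linarith [htpos n])
  have hκη : ∀ n x, κ n x * η n x = η n x := by
    intro n x
    rcases le_total |x - t n| (t n / 4) with hx | hx
    · rw [hκ1 n x hx, one_mul]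
    · rw [hη0 n x hx, mul_zero]
  have hκκ : ∀ m n, m < n → ∀ x, κ m x * κ n x = 0 := by
    intro m n hmn x
    by_cases h1 : t m / 2 ≤ |x - t m|
    · rw [hκ0 m x h1, zero_mul]
    · rw [hκ0 n x, mul_zero]
      have h2 := abs_lt.1 (not_le.1 h1)
      have h3 := hquarter m n hmn
      have := htpos n
      rw [abs_of_nonneg] <;> linarith
  have ksa : ∀ n, IsSelfAdjoint (cfcₙ (κ n) h) := fun n => cfcₙ_predicate (κ n) h
  have hy0 : ∀ n, cfcₙ (η n) h ≠ 0 := by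
    intro n hn
    have h1 := norm_apply_le_norm_cfcₙ (η n) h (htσ n) (cη n).continuousOn (ηz n)
    rw [hn, norm_zero] at h1
    have h2 : η n (t n) = t n / 4 := by
      have := htpos n
      simp only [η, sub_self, abs_zero, sub_zero]
      exact max_eq_right (by linarith)
    rw [h2] at h1
    have := norm_le_zero_iff.1 h1
    linarith [htpos n]
  have hky : ∀ n, cfcₙ (κ n) h * cfcₙ (η n) h = cfcₙ (η n) h := fun n => by
    rw [← cfcₙ_mul (κ n) (η n) h (cκ n).continuousOn (κz n) (cη n).continuousOn (ηz n)]
    exact cfcₙ_congr fun x _ => hκη n x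
  have hkk : ∀ m n, m ≠ n → cfcₙ (κ m) h * cfcₙ (κ n) h = 0 := by
    intro m n hmn
    rw [← cfcₙ_mul (κ m) (κ n) h (cκ m).continuousOn (κz m) (cκ n).continuousOn (κz n),
      ← cfcₙ_const_zero ℝ h]
    refine cfcₙ_congr fun x _ => ?_
    rcases hmn.lt_or_gt with h1 | h1
    · exact hκκ m n h1 x
    · simp only [mul_comm (κ m x), hκκ n m h1 x]
  have hex := fun n => hSP.exists_projection (ksa n) (hy0 n) (hky n)
    ((mul_eq_self_comm (ksa n) (cfcₙ_predicate (η n) h)).1 (hky n))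
  choose q hq hq0 hkq hqk using hex
  refine ⟨q, hq, hq0, fun m n hmn => ?_, tendsto_projection_mul_zero he hc hec hlim hq ?_⟩
  · calc q m * q n = (q m * cfcₙ (κ m) h) * (cfcₙ (κ n) h * q n) := by rw [hqk, hkq]
      _ = q m * (cfcₙ (κ m) h * cfcₙ (κ n) h) * q n := by simp only [mul_assoc]
      _ = 0 := by rw [hkk m n hmn, mul_zero, zero_mul]
  · refine squeeze_zero_norm (a := fun n => 3 / 2 * t n) (fun n => ?_)
      (by simpa using htlim.const_mul (3 / 2))
    have h1 : ‖cfcₙ (κ n) h * h‖ ≤ 3 / 2 * t n := by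
      nth_rewrite 2 [← cfcₙ_id' ℝ h]
      rw [← cfcₙ_mul (κ n) (fun x => x) h (cκ n).continuousOn (κz n) (by fun_prop) rfl]
      refine norm_cfcₙ_le fun x hx => ?_
      have hx0 : 0 ≤ x := quasispectrum_nonneg_of_nonneg h h0 x hx
      have := htpos n
      by_cases h2 : t n / 2 ≤ |x - t n|
      · rw [hκ0 n x h2, zero_mul, norm_zero]; positivity
      · have h3 := abs_lt.1 (not_le.1 h2)
        have h4 : 0 ≤ κ n x := le_min zero_le_one (le_max_left _ _)
        rw [Real.norm_of_nonneg (mul_nonneg h4 hx0)]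
        calc κ n x * x ≤ 1 * x := by gcongr; exact min_le_left _ _
          _ ≤ _ := by linarith
    calc ‖q n * h‖ = ‖q n * (cfcₙ (κ n) h * h)‖ := by rw [← mul_assoc, hqk]
      _ ≤ ‖q n‖ * ‖cfcₙ (κ n) h * h‖ := norm_mul_le _ _
      _ ≤ 1 * (3 / 2 * t n) := by gcongr; exact (hq n).norm_le
      _ = _ := one_mul _

/-- A sequence of partial isometries with pairwise orthogonal initial projections and pairwise
orthogonal final projections. -/
structure IsPartialIsometrySeq (v : ℕ → A) : Prop where
  mul_star_mul : ∀ n, v n * star (v n) * v n = v n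
  star_mul_of_ne : ∀ m n, m ≠ n → star (v m) * v n = 0
  mul_star_of_ne : ∀ m n, m ≠ n → v m * star (v n) = 0

/-- Partial isometries `v n` whose initial projections lie under a fixed projection `e`, while the
final projections tend strictly to `0`. -/
theorem exists_partialIsometries (hnu : IsNonUnital A) (hσ : IsSigmaUnital A)
    (hE : ¬ IsElementary A) (hA : IsSimpleCStar A) (hSP : HasSP A) :
    ∃ (e : A) (v : ℕ → A), IsStarProjection e ∧ (∀ n, v n * e = v n) ∧ (∀ n, v n ≠ 0) ∧
      IsPartialIsometrySeq v ∧ ∀ a, Tendsto (fun n => star (v n) * a) atTop (𝓝 0) := by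
  obtain ⟨q, hq, hq0, hqq, hqlim⟩ := exists_orthogonal_vanishing hnu hσ hSP
  obtain ⟨p, hp, hp0, hpp, hep⟩ := exists_orthogonal_subprojections hA hSP hE (hq 0) (hq0 0)
  choose v hv0 hv hqv hvp using fun n => exists_partialIsometry hA hSP (hq0 n) (hp0 n) (hq n) (hp n)
  have hvq : ∀ n, star (v n) * q n = star (v n) := fun n => by
    simpa [(hq n).isSelfAdjoint.star_eq] using congr(star $(hqv n))
  have hpv : ∀ n, p n * star (v n) = star (v n) := fun n => by
    simpa [(hp n).isSelfAdjoint.star_eq] using congr(star $(hvp n))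
  have hpe : ∀ n, p n * q 0 = p n := fun n =>
    (mul_eq_self_comm (hq 0).isSelfAdjoint (hp n).isSelfAdjoint).1 (hep n)
  refine ⟨q 0, v, hq 0, fun n => ?_, hv0, ⟨hv, fun m n hmn => ?_, fun m n hmn => ?_⟩, fun a => ?_⟩
  · rw [← hvp, mul_assoc, hpe]
  · rw [← hvq m, ← hqv n, mul_assoc, ← mul_assoc (q m), hqq hmn, zero_mul, mul_zero]
  · rw [← hvp m, ← hpv n, mul_assoc, ← mul_assoc (p m), hpp hmn, zero_mul, mul_zero]
  · have hn : ∀ n, ‖star (v n)‖ ≤ 1 := fun n => by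
      have h1 : ‖star (v n) * v n‖ ≤ 1 := by
        refine IsStarProjection.norm_le _ ⟨?_, .star_mul_self _⟩
        rw [IsIdempotentElem, mul_assoc, ← mul_assoc (v n), hv]
      rw [CStarRing.norm_star_mul_self] at h1
      rw [norm_star]
      nlinarith [norm_nonneg (v n)]
    refine squeeze_zero_norm (fun n => ?_) (tendsto_zero_iff_norm_tendsto_zero.1 (hqlim a))
    rw [← hvq, mul_assoc]
    exact (norm_mul_le _ _).trans (mul_le_of_le_one_left (norm_nonneg _) (hn n))

end Sequences

/-! ### A Dini theorem for positive functionals -/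

section Dini
open Filter Topology ComplexStarModule

variable [PartialOrder A] [StarOrderedRing A]

/-- A decreasing sequence of positive elements which tends to `0` on every positive functional tends
to `0` in norm. Otherwise `0` is not in the closure of the convex set of all `x` with `c n ≤ ℜ x`
for some `n`; this set is stable under adding positive elements, so a functional which separates it
from `0` is positive, and it is bounded below on the `c n`. -/
theorem tendsto_zero_of_forall_positive {c : ℕ → A} (hanti : Antitone c) (h0 : ∀ n, 0 ≤ c n)
    (h : ∀ φ : A →ₚ[ℂ] ℂ, Tendsto (fun n => φ (c n)) atTop (𝓝 0)) :
    Tendsto c atTop (𝓝 0) := by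
  by_contra hc
  obtain ⟨ε, hε, hεc⟩ : ∃ ε > 0, ∀ n, ε ≤ ‖c n‖ := by
    by_contra! hcon
    refine hc (tendsto_zero_iff_norm_tendsto_zero.2 (Metric.tendsto_atTop.2 fun ε hε => ?_))
    obtain ⟨N, hN⟩ := hcon ε hε
    refine ⟨N, fun n hn => ?_⟩
    rw [dist_zero_right, norm_norm]
    exact (CStarAlgebra.norm_le_norm_of_nonneg_of_le (h0 n) (hanti hn)).trans_lt hN
  let C : Set A := {x | ∃ n, c n ≤ (ℜ x : A)}
  have hre : ∀ {y : A}, IsSelfAdjoint y → (ℜ y : A) = y := fun hy => hy.coe_realPart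
  have hcC : ∀ n (z : A), 0 ≤ (ℜ z : A) → c n + z ∈ C := by
    intro n z hz
    refine ⟨n, ?_⟩
    rw [map_add, AddSubgroup.coe_add, hre (.of_nonneg (h0 n))]
    exact le_add_of_nonneg_right hz
  have hconv : Convex ℝ C := by
    rintro x ⟨m, hm⟩ y ⟨n, hn⟩ a b ha hb hab
    refine ⟨max m n, ?_⟩
    have h1 : c (max m n) ≤ (ℜ x : A) := (hanti (le_max_left m n)).trans hm
    have h2 : c (max m n) ≤ (ℜ y : A) := (hanti (le_max_right m n)).trans hn
    calc c (max m n) = a • c (max m n) + b • c (max m n) := by rw [← add_smul, hab, one_smul]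
      _ ≤ a • (ℜ x : A) + b • (ℜ y : A) :=
        add_le_add (smul_le_smul_of_nonneg_left h1 ha) (smul_le_smul_of_nonneg_left h2 hb)
      _ = _ := by simp
  have hC0 : (0 : A) ∉ closure C := by
    rw [Metric.mem_closure_iff]
    push Not
    refine ⟨ε, hε, ?_⟩
    rintro x ⟨n, hn⟩
    rw [dist_zero_left]
    calc ε ≤ ‖c n‖ := hεc n
      _ ≤ ‖(ℜ x : A)‖ := CStarAlgebra.norm_le_norm_of_nonneg_of_le (h0 n) hn
      _ ≤ ‖x‖ := realPart.norm_le x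
  obtain ⟨f, s, hs0, hs⟩ := RCLike.geometric_hahn_banach_point_closed (𝕜 := ℂ) hconv.closure
    isClosed_closure hC0
  simp only [map_zero] at hs0
  have hsC : ∀ x ∈ C, s < (f x).re := fun x hx => hs x (subset_closure hx)
  -- a functional bounded below on a set stable under `+ z` and its multiples is nonnegative at `z`
  have hpos : ∀ z : A, 0 ≤ (ℜ z : A) → 0 ≤ (f z).re := by
    intro z hz
    by_contra! hneg
    obtain ⟨t, ht⟩ := exists_nat_gt ((f (c 0)).re / -(f z).re)
    rw [div_lt_iff₀ (by linarith)] at ht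
    have h1 := hsC _ (hcC 0 ((t : ℝ) • z) (by
      rw [map_smul]; exact smul_nonneg (Nat.cast_nonneg _) hz))
    have h2 : f ((t : ℝ) • z) = (t : ℂ) * f z := by
      rw [← Complex.coe_smul, map_smul, smul_eq_mul, Complex.ofReal_natCast]
    have hs0' : (0 : ℝ) < s := by simpa using hs0
    have h3 : ((t : ℂ) * f z).re = t * (f z).re := by simp
    rw [map_add, h2, Complex.add_re, h3] at h1
    nlinarith
  have hfpos : ∀ y : A, 0 ≤ y → 0 ≤ f y := by
    intro y hy
    have hyr : (ℜ y : A) = y := hre (.of_nonneg hy)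
    have hI : (ℜ (Complex.I • y) : A) = 0 := by
      rw [realPart_I_smul, (IsSelfAdjoint.of_nonneg hy).imaginaryPart]; simp
    have h1 := hpos (Complex.I • y) hI.ge
    have h2 := hpos (-(Complex.I • y)) (by rw [map_neg, AddSubgroup.coe_neg, hI, neg_zero])
    rw [map_neg, map_smul, smul_eq_mul, Complex.neg_re, Complex.I_mul_re] at h2
    rw [map_smul, smul_eq_mul, Complex.I_mul_re] at h1
    rw [Complex.nonneg_iff]
    exact ⟨hpos y (by rw [hyr]; exact hy), by linarith⟩
  have h1 := h (PositiveLinearMap.mk₀ (f : A →ₗ[ℂ] ℂ) hfpos)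
  have h2 : Tendsto (fun n => (f (c n)).re) atTop (𝓝 0) :=
    (Complex.continuous_re.tendsto 0).comp h1
  have h3 : s ≤ 0 := ge_of_tendsto h2 (.of_forall fun n =>
    (hsC (c n) ⟨n, (hre (.of_nonneg (h0 n))).ge⟩).le)
  have hs0' : (0 : ℝ) < s := by simpa using hs0
  linarith

end Dini

/-! ### The universal representation -/

section UniversalRepresentation
open Filter Topology

variable [PartialOrder A] [StarOrderedRing A]

/-- Every positive functional is, up to a scalar, implemented by the GNS map `Λ` of a state into the
universal Hilbert space. The scalar allows for the zero functional, which is no multiple of a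
state. -/
theorem exists_gnsVector (ψ : A →ₚ[ℂ] ℂ) :
    ∃ (Λ : A →L[ℂ] UnivHilbert A) (r : ℂ), (∀ a b, univRep A a (Λ b) = Λ (a * b)) ∧
      ∀ a b, ψ (star a * b) = r * inner ℂ (Λ a) (Λ b) := by
  classical
  let ψc : A →L[ℂ] ℂ := ⟨ψ.toLinearMap, map_continuous ψ⟩
  have hψc : ∀ a, ψc a = ψ a := fun a => rfl
  by_cases hz : ψc = 0
  · refine ⟨0, 0, by simp, fun a b => ?_⟩
    rw [← hψc, hz]; simp
  have hn : 0 < ‖ψc‖ := norm_pos_iff.2 hz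
  let φ₀ : A →ₚ[ℂ] ℂ := PositiveLinearMap.mk₀ (((‖ψc‖⁻¹ : ℝ) : ℂ) • ψ.toLinearMap) fun a ha => by
    have h1 : (0 : ℂ) ≤ ((‖ψc‖⁻¹ : ℝ) : ℂ) := by
      rw [Complex.zero_le_real]; positivity
    exact mul_nonneg h1 (ψ.map_nonneg ha)
  have hφ₀ : ∀ a, φ₀ a = ((‖ψc‖⁻¹ : ℝ) : ℂ) * ψ a := fun a => rfl
  have hφn : (⟨φ₀.toLinearMap, map_continuous φ₀⟩ : A →L[ℂ] ℂ) = ((‖ψc‖⁻¹ : ℝ) : ℂ) • ψc := rfl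
  let φ : State A := ⟨φ₀, by
    rw [hφn, norm_smul, Complex.norm_real, norm_inv, norm_norm, inv_mul_cancel₀ hn.ne']⟩
  have hφle : ∀ a, ‖φ₀ a‖ ≤ ‖a‖ := fun a => by
    have h1 := (⟨φ₀.toLinearMap, map_continuous φ₀⟩ : A →L[ℂ] ℂ).le_opNorm a
    rw [φ.2, one_mul] at h1
    exact h1
  -- the summand of the universal Hilbert space that belongs to `φ`
  let ι : φ₀.GNS → UnivHilbert A := fun x => lp.single (E := fun χ : State A => χ.1.GNS) 2 φ x
  let Λ₀ : A →ₗ[ℂ] UnivHilbert A :=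
    { toFun := fun a => ι ((φ₀.toPreGNS a : φ₀.PreGNS) : φ₀.GNS)
      map_add' := fun a b => by
        rw [map_add, UniformSpace.Completion.coe_add]; exact lp.single_add 2 φ _ _
      map_smul' := fun c a => by
        rw [map_smul, UniformSpace.Completion.coe_smul]; exact lp.single_smul 2 φ _ _ }
  have hinner : ∀ a b, inner ℂ (Λ₀ a) (Λ₀ b) = φ₀ (star a * b) := by
    intro a b
    change inner ℂ (ι ((φ₀.toPreGNS a : φ₀.PreGNS) : φ₀.GNS)) (Λ₀ b) = _
    rw [lp.inner_single_left]
    change inner ℂ _ (ι ((φ₀.toPreGNS b : φ₀.PreGNS) : φ₀.GNS) φ) = _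
    rw [lp.single_apply_self, UniformSpace.Completion.inner_coe]
    rfl
  have hbound : ∀ a, ‖Λ₀ a‖ ≤ 1 * ‖a‖ := by
    intro a
    rw [one_mul]
    refine abs_le_of_sq_le_sq' ?_ (norm_nonneg _) |>.2
    have h1 : ‖Λ₀ a‖ ^ 2 = ‖φ₀ (star a * a)‖ := by
      rw [← hinner, inner_self_eq_norm_sq_to_K]; simp
    rw [h1, sq, ← CStarRing.norm_star_mul_self]
    exact hφle _
  refine ⟨Λ₀.mkContinuous 1 hbound, (‖ψc‖ : ℂ), fun a b => ?_, fun a b => ?_⟩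
  · change univRep A a (Λ₀ b) = Λ₀ (a * b)
    ext χ
    change χ.1.gnsNonUnitalStarAlgHom a
      (ι ((φ₀.toPreGNS b : φ₀.PreGNS) : φ₀.GNS) χ) =
      ι ((φ₀.toPreGNS (a * b) : φ₀.PreGNS) : φ₀.GNS) χ
    by_cases hχ : χ = φ
    · subst hχ
      rw [lp.single_apply_self, lp.single_apply_self]
      exact PositiveLinearMap.gnsNonUnitalStarAlgHom_apply_coe _
    · rw [lp.single_apply_ne _ _ _ hχ, lp.single_apply_ne _ _ _ hχ, map_zero]
  · change _ = _ * inner ℂ (Λ₀ a) (Λ₀ b)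
    rw [hinner, hφ₀, ← mul_assoc, ← Complex.ofReal_mul, mul_inv_cancel₀ hn.ne', Complex.ofReal_one,
      one_mul]

/-- If projections `P n` of `A` increase strongly to `p` and `p a = a` for an element `a` of `A`,
then `P n a → a` in norm. -/
theorem tendsto_mul_of_tendsto_strongly {P : ℕ → A} (hP : ∀ n, IsStarProjection (P n))
    (hmono : Monotone P) {p : UnivHilbert A →L[ℂ] UnivHilbert A}
    (hlim : ∀ x, Tendsto (fun n => univRep A (P n) x) atTop (𝓝 (p x))) {a : A}
    (ha : p * univRep A a = univRep A a) : Tendsto (fun n => P n * a) atTop (𝓝 a) := by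
  have hsq : ∀ n, star (a - P n * a) * (a - P n * a) = star a * a - star a * P n * a := by
    intro n
    rw [star_sub, star_mul, (hP n).isSelfAdjoint.star_eq, sub_mul, mul_sub, mul_sub,
      mul_assoc (star a) (P n) (P n * a), ← mul_assoc (P n) (P n), (hP n).isIdempotentElem.eq,
      mul_assoc, sub_self, sub_zero]
  have hc : Tendsto (fun n => star a * a - star a * P n * a) atTop (𝓝 0) := by
    refine tendsto_zero_of_forall_positive (fun m n hmn => ?_) (fun n => ?_) fun ψ => ?_
    · exact sub_le_sub_left (star_left_conjugate_le_conjugate (hmono hmn) a) _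
    · rw [← hsq]; exact star_mul_self_nonneg _
    · obtain ⟨Λ, r, hΛ, hψ⟩ := exists_gnsVector ψ
      -- `Λ a` lies in the closure of the range of `a`, on which `p` is the identity
      have hpΛ : p (Λ a) = Λ a := by
        have hu := (CStarAlgebra.increasingApproximateUnit A).tendsto_mul_left a
        have h1 : Tendsto (fun e => Λ (a * e)) (CStarAlgebra.approximateUnit A) (𝓝 (Λ a)) :=
          (Λ.continuous.tendsto a).comp hu
        have h2 := (p.continuous.tendsto _).comp h1
        refine tendsto_nhds_unique (h2.congr fun e => ?_) h1
        simp only [Function.comp, ← hΛ]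
        exact congr($ha (Λ e))
      have h3 : Tendsto (fun n => r * inner ℂ (Λ a) (univRep A (P n) (Λ a))) atTop
          (𝓝 (r * inner ℂ (Λ a) (p (Λ a)))) :=
        tendsto_const_nhds.mul (tendsto_const_nhds.inner (hlim (Λ a)))
      have h4 := tendsto_const_nhds (x := ψ (star a * a)) |>.sub h3
      rw [hpΛ, ← hψ, sub_self] at h4
      refine h4.congr fun n => ?_
      rw [hΛ, ← hψ, map_sub, mul_assoc]
  have h5 : Tendsto (fun n => ‖a - P n * a‖) atTop (𝓝 0) := by
    have := hc.norm.sqrt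
    simpa only [← hsq, CStarRing.norm_star_mul_self, norm_zero, Real.sqrt_zero,
      Real.sqrt_mul_self (norm_nonneg _)] using this
  exact tendsto_iff_norm_sub_tendsto_zero.2 (by simpa only [norm_sub_rev] using h5)

/-- Faithfulness is the case of zero projections of the norm convergence above. -/
theorem univRep_injective : Function.Injective (univRep A) := by
  rw [injective_iff_map_eq_zero]
  intro a ha
  have := tendsto_mul_of_tendsto_strongly (P := fun _ => (0 : A)) (p := 0) (a := a)
    (fun _ => .zero A) monotone_const (by simp) (by rw [ha, mul_zero])
  simp only [zero_mul] at this
  exact tendsto_nhds_unique this tendsto_const_nhds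

theorem isClosed_range_univRep : IsClosed (Set.range (univRep A)) :=
  (AddMonoidHomClass.isometry_of_norm (univRep A) fun a =>
    NonUnitalStarAlgHom.norm_map _ univRep_injective a).isClosedEmbedding.isClosed_range

theorem norm_univRep_le (a : A) : ‖univRep A a‖ ≤ ‖a‖ :=
  NonUnitalStarAlgHom.norm_apply_le (univRep A) a

theorem continuous_univRep : Continuous (univRep A) :=
  AddMonoidHomClass.continuous_of_bound (univRep A) 1 fun a => by
    rw [one_mul]; exact norm_univRep_le a

theorem mem_envelope_of_tendsto {T : ℕ → A} {t : UnivHilbert A →L[ℂ] UnivHilbert A}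
    (h : ∀ x, Tendsto (fun n => univRep A (T n) x) atTop (𝓝 (t x))) : t ∈ envelope A := by
  intro y hy
  ext1 x
  have h1 : Tendsto (fun n => y (univRep A (T n) x)) atTop (𝓝 (y (t x))) :=
    (y.continuous.tendsto _).comp (h x)
  refine tendsto_nhds_unique h1 ((h (y x)).congr fun n => ?_)
  exact congr($(hy _ ⟨T n, rfl⟩) x)

theorem univRep_mem_envelope (a : A) : univRep A a ∈ envelope A :=
  mem_envelope_of_tendsto (T := fun _ => a) fun _ => tendsto_const_nhds

end UniversalRepresentation

/-! ### Sums of orthogonal partial isometries in `A` -/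

section PartialIsometries
open Filter Topology

/-- The partial sums `v 0 + ⋯ + v (n - 1)`. -/
def partialSum (v : ℕ → A) (n : ℕ) : A := ∑ k ∈ Finset.range n, v k

/-- The initial projection `(v n)* v n` of `v n`. -/
def initialProj (v : ℕ → A) (n : ℕ) : A := star (v n) * v n

/-- A positive element whose range projection is the sum of the initial projections of `v`. -/
def supportElement (v : ℕ → A) : A := ∑' n, ((1 / 2 : ℝ) ^ n) • initialProj v n

theorem star_partialSum (v : ℕ → A) (n : ℕ) : star (partialSum v n) = partialSum (star v) n := by
  simp [partialSum]

namespace IsPartialIsometrySeq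

variable {v : ℕ → A} (hv : IsPartialIsometrySeq v)
include hv

protected theorem star : IsPartialIsometrySeq (star v) where
  mul_star_mul n := by
    simpa [mul_assoc] using congr(star $(hv.mul_star_mul n))
  star_mul_of_ne m n h := by simpa using hv.mul_star_of_ne m n h
  mul_star_of_ne m n h := by simpa using hv.star_mul_of_ne m n h

theorem mul_initialProj (n : ℕ) : v n * initialProj v n = v n := by
  rw [initialProj, ← mul_assoc, hv.mul_star_mul]

theorem mul_initialProj_of_ne {m n : ℕ} (h : m ≠ n) : v m * initialProj v n = 0 := by
  rw [initialProj, ← mul_assoc, hv.mul_star_of_ne m n h, zero_mul]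

theorem isStarProjection_initialProj (n : ℕ) : IsStarProjection (initialProj v n) := by
  refine ⟨?_, .star_mul_self _⟩
  rw [IsIdempotentElem, initialProj, mul_assoc, ← mul_assoc (v n), hv.mul_star_mul]

theorem initialProj_mul_initialProj_of_ne {m n : ℕ} (h : m ≠ n) :
    initialProj v m * initialProj v n = 0 := by
  conv_lhs => rw [initialProj, mul_assoc, hv.mul_initialProj_of_ne h, mul_zero]

theorem mul_partialSum_initialProj {m n : ℕ} (h : m < n) :
    v m * partialSum (initialProj v) n = v m := by
  rw [partialSum, Finset.mul_sum, Finset.sum_eq_single m, hv.mul_initialProj]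
  · exact fun k _ hk => hv.mul_initialProj_of_ne hk.symm
  · exact fun hm => absurd (Finset.mem_range.2 h) hm

theorem mul_partialSum_initialProj_of_le {m n : ℕ} (h : n ≤ m) :
    v m * partialSum (initialProj v) n = 0 := by
  rw [partialSum, Finset.mul_sum]
  exact Finset.sum_eq_zero fun k hk =>
    hv.mul_initialProj_of_ne (by have := Finset.mem_range.1 hk; omega)

/-- The partial sum over `k < n` of the initial projections cuts the sum of `v` over `k < m` down to
the indices below both bounds. -/
theorem partialSum_mul {m n : ℕ} :
    partialSum v m * partialSum (initialProj v) n = partialSum v (min m n) := by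
  induction m with
  | zero => simp [partialSum]
  | succ m ih =>
    have hs : ∀ k, partialSum v (k + 1) = partialSum v k + v k := fun k => Finset.sum_range_succ _ _
    rw [hs, add_mul, ih]
    rcases lt_or_ge m n with h | h
    · rw [hv.mul_partialSum_initialProj h, min_eq_left h.le, min_eq_left (Nat.succ_le_of_lt h), hs]
    · rw [hv.mul_partialSum_initialProj_of_le h, min_eq_right h, min_eq_right (h.trans m.le_succ),
        add_zero]

theorem star_partialSum_mul (n : ℕ) :
    star (partialSum v n) * partialSum v n = partialSum (initialProj v) n := by
  simp only [partialSum, star_sum, Finset.sum_mul]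
  refine Finset.sum_congr rfl fun k hk => ?_
  rw [Finset.mul_sum, Finset.sum_eq_single k]
  · rfl
  · exact fun m _ hm => hv.star_mul_of_ne k m hm.symm
  · exact fun h => absurd hk h

/-- The initial projections form a sequence of partial isometries themselves. -/
theorem initial : IsPartialIsometrySeq (initialProj v) where
  mul_star_mul n := by
    have h := hv.isStarProjection_initialProj n
    rw [h.isSelfAdjoint.star_eq, h.isIdempotentElem.eq, h.isIdempotentElem.eq]
  star_mul_of_ne m n h := by
    rw [(hv.isStarProjection_initialProj m).isSelfAdjoint.star_eq,
      hv.initialProj_mul_initialProj_of_ne h]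
  mul_star_of_ne m n h := by
    rw [(hv.isStarProjection_initialProj n).isSelfAdjoint.star_eq,
      hv.initialProj_mul_initialProj_of_ne h]

theorem initialProj_initialProj : initialProj (initialProj v) = initialProj v := by
  ext n
  have h := hv.isStarProjection_initialProj n
  rw [initialProj, h.isSelfAdjoint.star_eq, h.isIdempotentElem.eq]

theorem partialSum_initialProj_mul {m n : ℕ} :
    partialSum (initialProj v) m * partialSum (initialProj v) n =
      partialSum (initialProj v) (min m n) := by
  have := hv.initial.partialSum_mul (m := m) (n := n)
  rwa [hv.initialProj_initialProj] at this

theorem isStarProjection_partialSum (n : ℕ) :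
    IsStarProjection (partialSum (initialProj v) n) := by
  refine ⟨?_, ?_⟩
  · rw [IsIdempotentElem, hv.partialSum_initialProj_mul, min_self]
  · rw [← hv.star_partialSum_mul]; exact .star_mul_self _

theorem norm_initialProj_le (n : ℕ) : ‖initialProj v n‖ ≤ 1 :=
  (hv.isStarProjection_initialProj n).norm_le

theorem norm_eq_one {n : ℕ} (h : v n ≠ 0) : ‖v n‖ = 1 := by
  have h1 : ‖initialProj v n‖ = ‖v n‖ * ‖v n‖ := CStarRing.norm_star_mul_self
  have hp := hv.isStarProjection_initialProj n
  have h2 := CStarRing.norm_star_mul_self (x := initialProj v n)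
  rw [hp.isSelfAdjoint.star_eq, hp.isIdempotentElem.eq, h1] at h2
  have := norm_pos_iff.2 h
  have h3 : ‖v n‖ * ‖v n‖ = 1 := by
    have : 0 < ‖v n‖ * ‖v n‖ := by positivity
    nlinarith
  nlinarith

theorem summable_supportElement : Summable fun n => ((1 / 2 : ℝ) ^ n) • initialProj v n := by
  refine Summable.of_norm_bounded (g := fun n : ℕ => (1 / 2 : ℝ) ^ n)
    summable_geometric_two fun n => ?_
  rw [norm_smul, Real.norm_of_nonneg (by positivity)]
  exact mul_le_of_le_one_right (by positivity) (hv.norm_initialProj_le n)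

theorem tendsto_supportElement :
    Tendsto (partialSum fun n => ((1 / 2 : ℝ) ^ n) • initialProj v n) atTop
      (𝓝 (supportElement v)) :=
  hv.summable_supportElement.hasSum.tendsto_sum_nat

theorem supportElement_mul_initialProj (k : ℕ) :
    supportElement v * initialProj v k = ((1 / 2 : ℝ) ^ k) • initialProj v k := by
  rw [supportElement, ← hv.summable_supportElement.tsum_mul_right, tsum_eq_single k]
  · rw [smul_mul_assoc, (hv.isStarProjection_initialProj k).isIdempotentElem.eq]
  · intro n hn
    rw [smul_mul_assoc, hv.initialProj_mul_initialProj_of_ne hn, smul_zero]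

theorem partialSum_mul_supportElement (n : ℕ) :
    partialSum (initialProj v) n * supportElement v =
      partialSum (fun n => ((1 / 2 : ℝ) ^ n) • initialProj v n) n := by
  have h1 : ∀ k, initialProj v k * supportElement v = ((1 / 2 : ℝ) ^ k) • initialProj v k := by
    intro k
    rw [supportElement, ← hv.summable_supportElement.tsum_mul_left, tsum_eq_single k]
    · rw [mul_smul_comm, (hv.isStarProjection_initialProj k).isIdempotentElem.eq]
    · intro n hn
      rw [mul_smul_comm, hv.initialProj_mul_initialProj_of_ne hn.symm, smul_zero]
  simp only [partialSum, Finset.sum_mul, h1]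

/-- The partial sums of the initial projections lie in the right ideal generated by the support
element. -/
theorem exists_partialSum_eq (n : ℕ) :
    ∃ g, partialSum (initialProj v) n = supportElement v * g := by
  refine ⟨∑ k ∈ Finset.range n, ((2 : ℝ) ^ k) • initialProj v k, ?_⟩
  rw [Finset.mul_sum]
  refine Finset.sum_congr rfl fun k _ => ?_
  rw [mul_smul_comm, hv.supportElement_mul_initialProj, smul_smul, ← mul_pow]
  norm_num

end IsPartialIsometrySeq
end PartialIsometries

/-! ### Strong limits in the enveloping von Neumann algebra -/

section SupportProjection
open Filter Topology
variable [PartialOrder A] [StarOrderedRing A]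

/-- The sum of the initial projections of `v` in the enveloping von Neumann algebra. -/
def supportProjection (v : ℕ → A) : UnivHilbert A →L[ℂ] UnivHilbert A :=
  rangeProjection (supportElement v)

theorem isStarProjection_supportProjection (v : ℕ → A) :
    IsStarProjection (supportProjection v) :=
  isStarProjection_starProjection

namespace IsPartialIsometrySeq

variable {v : ℕ → A} (hv : IsPartialIsometrySeq v)
include hv

omit hv in
theorem supportElement_nonneg : 0 ≤ supportElement v :=
  tsum_nonneg fun n => smul_nonneg (by positivity) (star_mul_self_nonneg (v n))

omit hv in
theorem monotone_partialSum : Monotone (partialSum (initialProj v)) := by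
  refine monotone_nat_of_le_succ fun n => ?_
  rw [partialSum, partialSum, Finset.sum_range_succ]
  exact le_add_of_nonneg_right (star_mul_self_nonneg (v n))

/-- The range projection of `supportElement v` is the strong limit of the partial sums of the
initial projections. -/
theorem tendsto_supportProjection (x : UnivHilbert A) :
    Tendsto (fun n => univRep A (partialSum (initialProj v) n) x) atTop
      (𝓝 (supportProjection v x)) := by
  set P := partialSum (initialProj v) with hP
  set h := supportElement v with hh
  have hPn : ∀ n, ‖univRep A (P n)‖ ≤ 1 := fun n =>
    (norm_univRep_le _).trans (hv.isStarProjection_partialSum n).norm_le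
  set K := (univRep A h).range with hK
  have hrange : ∀ y ∈ K, Tendsto (fun n => univRep A (P n) y) atTop (𝓝 y) := by
    rintro _ ⟨y, rfl⟩
    have h1 : Tendsto (fun n => univRep A (P n * h)) atTop (𝓝 (univRep A h)) := by
      exact (continuous_univRep.tendsto h).comp
        (hv.tendsto_supportElement.congr fun n => (hv.partialSum_mul_supportElement n).symm)
    have h2 : Tendsto (fun n => univRep A (P n * h) y) atTop (𝓝 (univRep A h y)) :=
      ((ContinuousLinearMap.apply ℂ _ y).continuous.tendsto _).comp h1
    simpa only [map_mul] using! h2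
  have hclosure : ∀ y ∈ K.topologicalClosure,
      Tendsto (fun n => univRep A (P n) y) atTop (𝓝 y) := by
    intro y hy
    rw [Metric.tendsto_atTop]
    intro ε hε
    obtain ⟨z, hz, hyz⟩ := Metric.mem_closure_iff.1 hy (ε / 3) (by positivity)
    obtain ⟨N, hN⟩ := Metric.tendsto_atTop.1 (hrange z hz) (ε / 3) (by positivity)
    refine ⟨N, fun n hn => ?_⟩
    have h1 : dist (univRep A (P n) y) (univRep A (P n) z) ≤ dist y z := by
      rw [dist_eq_norm, dist_eq_norm, ← map_sub]
      exact ((univRep A (P n)).le_of_opNorm_le (hPn n) _).trans (by rw [one_mul])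
    calc dist (univRep A (P n) y) y ≤ dist (univRep A (P n) y) (univRep A (P n) z) +
          dist (univRep A (P n) z) z + dist z y := dist_triangle4 _ _ _ _
      _ < ε / 3 + ε / 3 + ε / 3 := by
          have := hN n hn
          rw [dist_comm z y]
          linarith
      _ = ε := by ring
  -- each partial sum lies in `h A`, so it kills the complement of the range of `h`
  have horth : ∀ n, univRep A (P n) (x - supportProjection v x) = 0 := by
    intro n
    obtain ⟨g, hg⟩ := hv.exists_partialSum_eq n
    have hPmem : ∀ y, univRep A (P n) y ∈ K.topologicalClosure := fun y => by
      refine Submodule.le_topologicalClosure _ ⟨univRep A g y, ?_⟩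
      rw [hP, hg, map_mul]; rfl
    have hsa : star (univRep A (P n)) = univRep A (P n) := by
      rw [← map_star, (hv.isStarProjection_partialSum n).isSelfAdjoint.star_eq]
    rw [← inner_self_eq_zero (𝕜 := ℂ)]
    nth_rewrite 1 [← hsa]
    rw [ContinuousLinearMap.star_eq_adjoint, ContinuousLinearMap.adjoint_inner_left]
    exact Submodule.starProjection_inner_eq_zero _ _ (hPmem _)
  have h1 := hclosure (supportProjection v x) (Submodule.starProjection_apply_mem _ _)
  refine h1.congr fun n => ?_
  rw [← sub_eq_zero, ← map_sub, ← neg_sub, map_neg, horth, neg_zero]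

theorem supportProjection_mem_envelope : supportProjection v ∈ envelope A :=
  mem_envelope_of_tendsto hv.tendsto_supportProjection

theorem univRep_mul_supportProjection (n : ℕ) :
    univRep A (partialSum v n) * supportProjection v = univRep A (partialSum v n) := by
  ext1 x
  have h1 : Tendsto
      (fun m => univRep A (partialSum v n) (univRep A (partialSum (initialProj v) m) x)) atTop
      (𝓝 (univRep A (partialSum v n) (supportProjection v x))) :=
    ((univRep A (partialSum v n)).continuous.tendsto _).comp (hv.tendsto_supportProjection x)
  refine tendsto_nhds_unique h1 (tendsto_const_nhds.congr' ?_)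
  filter_upwards [eventually_ge_atTop n] with m hm
  rw [← mul_apply_eq_comp, ← map_mul, hv.partialSum_mul, min_eq_left hm]

theorem isSigmaCompactOpen_supportProjection : IsSigmaCompactOpen (supportProjection v) := by
  refine ⟨⟨hv.supportProjection_mem_envelope, isStarProjection_supportProjection v,
    Set.range (partialSum (initialProj v)), Set.range_nonempty _, ?_, ?_, ?_, ?_⟩,
    supportElement v, supportElement_nonneg, rfl⟩
  · exact monotone_partialSum.directed_le.directedOn_range
  · rintro _ ⟨n, rfl⟩
    exact (hv.isStarProjection_partialSum n).nonneg
  · rintro _ ⟨_, ⟨n, rfl⟩, rfl⟩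
    have hP := hv.isStarProjection_partialSum n
    have hπP : IsStarProjection (univRep A (partialSum (initialProj v) n)) :=
      ⟨by rw [IsIdempotentElem, ← map_mul, hP.isIdempotentElem.eq],
        by rw [IsSelfAdjoint, ← map_star, hP.isSelfAdjoint.star_eq]⟩
    refine hπP.le_of_mul_eq_left (isStarProjection_supportProjection v) ?_
    rw [← hv.star_partialSum_mul, map_mul, mul_assoc, hv.univRep_mul_supportProjection]
  · intro T hT
    rw [ContinuousLinearMap.le_def, ContinuousLinearMap.isPositive_iff_complex]
    intro x
    rw [← RCLike.ofReal_nonneg (K := ℂ)]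
    suffices h : 0 ≤ inner ℂ ((T - supportProjection v) x) x from
      ⟨Complex.ext rfl (Complex.nonneg_iff.1 h).2,
        Complex.zero_le_real.2 (Complex.nonneg_iff.1 h).1⟩
    have hlim : Tendsto (fun n => inner ℂ ((T - univRep A (partialSum (initialProj v) n)) x) x)
        atTop (𝓝 (inner ℂ ((T - supportProjection v) x) x)) :=
      (tendsto_const_nhds.sub (hv.tendsto_supportProjection x)).inner tendsto_const_nhds
    refine ge_of_tendsto' hlim fun n => ?_
    exact (ContinuousLinearMap.le_def _ _).1 (hT ⟨_, ⟨n, rfl⟩, rfl⟩) |>.inner_nonneg_left x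

theorem univRep_apply_mul_supportProjection (n : ℕ) :
    univRep A (v n) * supportProjection v = univRep A (v n) := by
  have : v n = partialSum v (n + 1) - partialSum v n := by
    rw [partialSum, partialSum, Finset.sum_range_succ, add_sub_cancel_left]
  rw [this, map_sub, sub_mul, hv.univRep_mul_supportProjection, hv.univRep_mul_supportProjection]

/-- The partial sums of `v` converge strongly, because those of the initial projections do and
`V n - V m = V n (P n - P m)`. -/
theorem exists_strongLimit : ∃ w : UnivHilbert A →L[ℂ] UnivHilbert A,
    ∀ x, Tendsto (fun n => univRep A (partialSum v n) x) atTop (𝓝 (w x)) := by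
  have hconv : ∀ x, ∃ y, Tendsto (fun n => univRep A (partialSum v n) x) atTop (𝓝 y) := by
    intro x
    refine cauchySeq_tendsto_of_complete ?_
    have hP : CauchySeq fun n => univRep A (partialSum (initialProj v) n) x :=
      (hv.tendsto_supportProjection x).cauchySeq
    rw [Metric.cauchySeq_iff'] at hP ⊢
    intro ε hε
    obtain ⟨N, hN⟩ := hP ε hε
    refine ⟨N, fun n hn => lt_of_le_of_lt ?_ (hN n hn)⟩
    -- `V n - V N = V n (P n - P N)`, and `V n` is a contraction
    have h1 : partialSum v n - partialSum v N =
        partialSum v n * (partialSum (initialProj v) n - partialSum (initialProj v) N) := by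
      rw [mul_sub, hv.partialSum_mul, hv.partialSum_mul, min_self, min_eq_right hn]
    have h2 : ‖partialSum v n‖ ≤ 1 := by
      have h3 : ‖partialSum v n‖ * ‖partialSum v n‖ ≤ 1 := by
        rw [← CStarRing.norm_star_mul_self, hv.star_partialSum_mul]
        exact (hv.isStarProjection_partialSum n).norm_le
      nlinarith [norm_nonneg (partialSum v n)]
    rw [dist_eq_norm, dist_eq_norm, ← sub_apply, ← map_sub, h1, map_mul,
      map_sub]
    exact ((univRep A (partialSum v n)).le_of_opNorm_le ((norm_univRep_le _).trans h2) _).trans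
      (by rw [one_mul]; rfl)
  choose w hw using hconv
  exact ⟨continuousLinearMapOfTendsto (fun n => univRep A (partialSum v n)) (tendsto_pi_nhds.2 hw),
    hw⟩

/-- The partial sums of `v` converge *-strongly. -/
theorem exists_strongLimit_star : ∃ w : UnivHilbert A →L[ℂ] UnivHilbert A,
    (∀ x, Tendsto (fun n => univRep A (partialSum v n) x) atTop (𝓝 (w x))) ∧
    ∀ x, Tendsto (fun n => univRep A (partialSum (star v) n) x) atTop (𝓝 (star w x)) := by
  obtain ⟨w, hw⟩ := hv.exists_strongLimit
  obtain ⟨w', hw'⟩ := hv.star.exists_strongLimit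
  have : w' = star w := by
    rw [ContinuousLinearMap.star_eq_adjoint, ContinuousLinearMap.eq_adjoint_iff]
    intro x y
    refine tendsto_nhds_unique ((hw' x).inner tendsto_const_nhds)
      ((tendsto_const_nhds.inner (hw y)).congr fun n => ?_)
    rw [← star_partialSum, map_star, ContinuousLinearMap.star_eq_adjoint,
      ContinuousLinearMap.adjoint_inner_left]
  exact ⟨w, hw, this ▸ hw'⟩

variable {w : UnivHilbert A →L[ℂ] UnivHilbert A}
  (hw : ∀ x, Tendsto (fun n => univRep A (partialSum v n) x) atTop (𝓝 (w x)))
include hw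

theorem star_strongLimit_mul : star w * w = supportProjection v := by
  ext1 x
  refine ext_inner_right ℂ fun y => ?_
  rw [mul_apply_eq_comp, ContinuousLinearMap.star_eq_adjoint,
    ContinuousLinearMap.adjoint_inner_left]
  refine tendsto_nhds_unique ((hw x).inner (hw y))
    (((hv.tendsto_supportProjection x).inner tendsto_const_nhds).congr fun n => ?_)
  rw [← hv.star_partialSum_mul, map_mul, map_star, mul_apply_eq_comp,
    ContinuousLinearMap.star_eq_adjoint, ContinuousLinearMap.adjoint_inner_left]

theorem strongLimit_mul_univRep_partialSum (n : ℕ) :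
    w * univRep A (partialSum (initialProj v) n) = univRep A (partialSum v n) := by
  ext1 x
  refine tendsto_nhds_unique (hw _) (tendsto_const_nhds.congr' ?_)
  filter_upwards [eventually_ge_atTop n] with m hm
  change _ = (univRep A (partialSum v m) * univRep A (partialSum (initialProj v) n)) x
  rw [← map_mul, hv.partialSum_mul, min_eq_right hm]

theorem strongLimit_mul_supportProjection : w * supportProjection v = w := by
  ext1 x
  refine tendsto_nhds_unique ((w.continuous.tendsto _).comp (hv.tendsto_supportProjection x))
    ((hw x).congr fun n => ?_)
  rw [← hv.strongLimit_mul_univRep_partialSum hw n]; rfl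

end IsPartialIsometrySeq

theorem mul_eq_of_mem_Her {p : UnivHilbert A →L[ℂ] UnivHilbert A} (hp : IsStarProjection p) {a : A}
    (ha : a ∈ Her p) : p * univRep A a = univRep A a ∧ univRep A a * p = univRep A a := by
  obtain ⟨x, -, hx⟩ := ha
  rw [hx]
  constructor
  · rw [← mul_assoc, ← mul_assoc, hp.isIdempotentElem.eq]
  · rw [mul_assoc, hp.isIdempotentElem.eq]

end SupportProjection

/-! ### Cuntz equivalence and pre-compactness -/

section CuntzEquivalence
open Filter Topology

variable [PartialOrder A] [StarOrderedRing A]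

theorem star_mem_Her {p : UnivHilbert A →L[ℂ] UnivHilbert A} (hp : IsStarProjection p) {a : A}
    (ha : a ∈ Her p) : star a ∈ Her p := by
  obtain ⟨x, hx, h⟩ := ha
  refine ⟨star x, star_mem hx, ?_⟩
  rw [map_star, h, star_mul, star_mul, hp.isSelfAdjoint.star_eq, mul_assoc]

namespace IsPartialIsometrySeq

variable {v : ℕ → A} (hv : IsPartialIsometrySeq v)
include hv

theorem tendsto_partialSum_mul {a : A} (ha : supportProjection v * univRep A a = univRep A a) :
    Tendsto (fun n => partialSum (initialProj v) n * a) atTop (𝓝 a) :=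
  tendsto_mul_of_tendsto_strongly hv.isStarProjection_partialSum monotone_partialSum
    hv.tendsto_supportProjection ha

variable {w : UnivHilbert A →L[ℂ] UnivHilbert A}
  (hw : ∀ x, Tendsto (fun n => univRep A (partialSum v n) x) atTop (𝓝 (w x)))
  (hw' : ∀ x, Tendsto (fun n => univRep A (partialSum (star v) n) x) atTop (𝓝 (star w x)))
include hw

theorem strongLimit_mul_mem_range {a : A} (ha : a ∈ Her (supportProjection v)) :
    w * univRep A a ∈ Set.range (univRep A) := by
  have h1 := hv.tendsto_partialSum_mul
    (mul_eq_of_mem_Her (isStarProjection_supportProjection v) ha).1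
  have h2 := tendsto_const_nhds (x := w) |>.mul ((continuous_univRep.tendsto a).comp h1)
  refine isClosed_range_univRep.mem_of_tendsto h2 (.of_forall fun n => ?_)
  simp only [Function.comp, map_mul, ← mul_assoc, hv.strongLimit_mul_univRep_partialSum hw]
  exact ⟨partialSum v n * a, map_mul _ _ _⟩

include hw'

/-- Conjugation by the strong limit `w` maps `Her` of the initial projection into `Her` of the final
projection: `w a w*` is the norm limit of the elements `V n a (V n)*` of `A`. -/
theorem strongLimit_conjugate_mem_Her {a : A} (ha : a ∈ Her (supportProjection v)) :
    ∃ b ∈ Her (supportProjection (star v)), w * univRep A a * star w = univRep A b := by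
  have hp := isStarProjection_supportProjection v
  have h1 := hv.tendsto_partialSum_mul (mul_eq_of_mem_Her hp ha).1
  have h2 : Tendsto (fun n => a * partialSum (initialProj v) n) atTop (𝓝 a) := by
    have h3 := hv.tendsto_partialSum_mul (mul_eq_of_mem_Her hp (star_mem_Her hp ha)).1
    have h4 := h3.star
    simpa only [star_mul, star_star, (hv.isStarProjection_partialSum _).isSelfAdjoint.star_eq]
      using h4
  have hP : ∀ n, ‖partialSum (initialProj v) n‖ ≤ 1 := fun n =>
    (hv.isStarProjection_partialSum n).norm_le
  have h5 : Tendsto (fun n => partialSum (initialProj v) n * a * partialSum (initialProj v) n)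
      atTop (𝓝 a) := by
    have h6 : Tendsto (fun n => partialSum (initialProj v) n *
        (a * partialSum (initialProj v) n - a)) atTop (𝓝 0) := by
      have h7 : Tendsto (fun n => ‖a * partialSum (initialProj v) n - a‖) atTop (𝓝 0) :=
        tendsto_iff_norm_sub_tendsto_zero.1 h2
      refine squeeze_zero_norm (fun n => ?_) h7
      exact (norm_mul_le _ _).trans (mul_le_of_le_one_left (norm_nonneg _) (hP n))
    have h8 := h6.add h1
    rw [zero_add] at h8
    refine h8.congr fun n => ?_
    rw [mul_sub, mul_assoc, sub_add_cancel]
  have h9 := (tendsto_const_nhds (x := w) |>.mul ((continuous_univRep.tendsto a).comp h5)).mul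
    (tendsto_const_nhds (x := star w))
  obtain ⟨b, hb⟩ : w * univRep A a * star w ∈ Set.range (univRep A) := by
    refine isClosed_range_univRep.mem_of_tendsto h9 (.of_forall fun n => ?_)
    have h10 : univRep A (partialSum (initialProj v) n) * star w =
        star (univRep A (partialSum v n)) := by
      rw [← hv.strongLimit_mul_univRep_partialSum hw, star_mul, ← map_star,
        (hv.isStarProjection_partialSum n).isSelfAdjoint.star_eq]
    refine ⟨partialSum v n * a * star (partialSum v n), ?_⟩
    simp only [Function.comp, map_mul, map_star]
    rw [← h10, ← hv.strongLimit_mul_univRep_partialSum hw]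
    simp only [mul_assoc]
  refine ⟨b, ⟨w * univRep A a * star w, ?_, ?_⟩, hb.symm⟩
  · have hwe : w ∈ envelope A := mem_envelope_of_tendsto hw
    exact mul_mem (mul_mem hwe (univRep_mem_envelope a)) (star_mem hwe)
  · have h11 := hv.star.strongLimit_mul_supportProjection hw'
    have h12 : supportProjection (star v) * w = w := by
      simpa [(isStarProjection_supportProjection (star v)).isSelfAdjoint.star_eq] using
        congr(star $h11)
    calc univRep A b = w * univRep A a * star w := hb
      _ = supportProjection (star v) * w * univRep A a *
          (star w * supportProjection (star v)) := by rw [h11, h12]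
      _ = _ := by simp only [mul_assoc]

end IsPartialIsometrySeq

theorem cuntzEquiv_supportProjection {v : ℕ → A} (hv : IsPartialIsometrySeq v) :
    CuntzEquiv (supportProjection v) (supportProjection (star v)) := by
  obtain ⟨w, hw, hw'⟩ := hv.exists_strongLimit_star
  refine ⟨w, mem_envelope_of_tendsto hw, hv.star_strongLimit_mul hw, ?_, fun a ha =>
    ⟨hv.strongLimit_conjugate_mem_Her hw hw' ha, hv.strongLimit_mul_mem_range hw ha⟩, fun b hb =>
    ⟨?_, hv.star.strongLimit_mul_mem_range hw' hb⟩⟩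
  · simpa using hv.star.star_strongLimit_mul hw'
  · have := hv.star.strongLimit_conjugate_mem_Her hw' (by simpa using hw) hb
    simpa using this

/-- The sum of projections lying under a projection `e` of `A` is pre-compact, witnessed by `e`. -/
theorem isPrecompact_supportProjection {v : ℕ → A} (hv : IsPartialIsometrySeq v) {e : A}
    (he : IsStarProjection e) (hve : ∀ n, v n * e = v n) : IsPrecompact (supportProjection v) := by
  have h1 : univRep A e * supportProjection v = supportProjection v := by
    ext1 x
    refine tendsto_nhds_unique
      (((univRep A e).continuous.tendsto _).comp (hv.tendsto_supportProjection x))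
      ((hv.tendsto_supportProjection x).congr fun n => ?_)
    have h2 : partialSum (initialProj v) n = e * partialSum (initialProj v) n := by
      simp only [partialSum, Finset.mul_sum]
      refine Finset.sum_congr rfl fun k _ => ?_
      have h3 := congr(star $(hve k))
      rw [star_mul, he.isSelfAdjoint.star_eq] at h3
      rw [initialProj, ← mul_assoc, h3]
    conv_lhs => rw [h2, map_mul]
    rfl
  refine ⟨e, he.nonneg, ?_, h1⟩
  have := congr(star $h1)
  rwa [star_mul, ← map_star, he.isSelfAdjoint.star_eq,
    (isStarProjection_supportProjection v).isSelfAdjoint.star_eq] at this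

/-- If `p a = p` for the support projection `p` of `v`, then `v n = v n a`, which tends to `0`
although every `v n` has norm one. -/
theorem not_isPrecompact_supportProjection {v : ℕ → A} (hv : IsPartialIsometrySeq v)
    (hv0 : ∀ n, v n ≠ 0) (hlim : ∀ a, Tendsto (fun n => v n * a) atTop (𝓝 0)) :
    ¬ IsPrecompact (supportProjection v) := by
  rintro ⟨a, -, ha, -⟩
  have h1 : ∀ n, v n * a = v n := fun n => univRep_injective <| by
    rw [map_mul, ← hv.univRep_apply_mul_supportProjection, mul_assoc, ha]
  have h2 := (hlim a).norm
  simp only [h1, hv.norm_eq_one (hv0 _), norm_zero] at h2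
  exact one_ne_zero (tendsto_nhds_unique tendsto_const_nhds h2)

/-- If `a` witnesses the pre-compactness of `p`, then `w* a w` witnesses that of `w* p w`. It is the
image of the positive element `c* c` of `A`, where `c = a^(1/2) w`. -/
theorem IsPrecompact.unitary_conjugate {p w : UnivHilbert A →L[ℂ] UnivHilbert A}
    (hp : IsPrecompact p) (hw : w ∈ multiplierAlgebra A)
    (hwu : w ∈ unitary (UnivHilbert A →L[ℂ] UnivHilbert A)) : IsPrecompact (star w * p * w) := by
  obtain ⟨a, ha, h1, h2⟩ := hp
  set s := CFC.sqrt a with hs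
  have hss : s * s = a := CFC.sqrt_mul_sqrt_self a ha
  have hssa : IsSelfAdjoint s := .of_nonneg (CFC.sqrt_nonneg _)
  obtain ⟨c, hc⟩ := (hw.2 s).2
  have hcc : univRep A (star c * c) = star w * univRep A a * w := by
    rw [map_mul, map_star, hc, star_mul, ← map_star, hssa.star_eq, ← hss, map_mul]
    simp only [mul_assoc]
  have hww : ∀ x, w * (star w * x) = x := fun x => by
    rw [← mul_assoc, Unitary.mul_star_self_of_mem hwu, one_mul]
  refine ⟨star c * c, star_mul_self_nonneg c, ?_, ?_⟩
  · rw [hcc]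
    calc star w * p * w * (star w * univRep A a * w)
        = star w * (p * (w * (star w * (univRep A a * w)))) := by simp only [mul_assoc]
      _ = star w * p * w := by rw [hww, ← mul_assoc p, h1, mul_assoc]
  · rw [hcc]
    calc star w * univRep A a * w * (star w * p * w)
        = star w * (univRep A a * (w * (star w * (p * w)))) := by simp only [mul_assoc]
      _ = star w * p * w := by rw [hww, ← mul_assoc _ p, h2, mul_assoc]

end CuntzEquivalence
end CStarOpen

end

theorem proposition2p10 {A : Type u} [NonUnitalCStarAlgebra A] [PartialOrder A]
    [StarOrderedRing A]
    (hnonunital : CStarOpen.IsNonUnital A)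
    (hsigma : CStarOpen.IsSigmaUnital A)
    (hnonelementary : ¬ CStarOpen.IsElementary A)
    (hsimple : CStarOpen.IsSimpleCStar A)
    (hSP : CStarOpen.HasSP A) :
    ∃ p q : CStarOpen.UnivHilbert A →L[ℂ] CStarOpen.UnivHilbert A,
      CStarOpen.IsSigmaCompactOpen p ∧ CStarOpen.IsSigmaCompactOpen q ∧
      CStarOpen.CuntzEquiv p q ∧
      (¬ ∃ w ∈ CStarOpen.multiplierAlgebra A,
        w ∈ unitary (CStarOpen.UnivHilbert A →L[ℂ] CStarOpen.UnivHilbert A) ∧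
          star w * p * w = q) ∧
      CStarOpen.IsPrecompact p ∧ ¬ CStarOpen.IsPrecompact q := by
  obtain ⟨e, v, he, hve, hv0, hv, hlim⟩ :=
    CStarOpen.exists_partialIsometries hnonunital hsigma hnonelementary hsimple hSP
  have hp := CStarOpen.isPrecompact_supportProjection hv he hve
  have hq := CStarOpen.not_isPrecompact_supportProjection hv.star
    (fun n => star_ne_zero.2 (hv0 n)) hlim
  refine ⟨CStarOpen.supportProjection v, CStarOpen.supportProjection (star v),
    hv.isSigmaCompactOpen_supportProjection, hv.star.isSigmaCompactOpen_supportProjection,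
    CStarOpen.cuntzEquiv_supportProjection hv, ?_, hp, hq⟩
  rintro ⟨w, hw, hwu, h⟩
  exact hq (h ▸ hp.unitary_conjugate hw hwu)
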